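/- **Theorem (expected total sample complexity of SASS for expected risk minimization).** *Problem.* Let $D$ be a probability distribution of data points, $l(x,d)$ a jointly measurable loss, differentiable in $x\in\mathbb R^m$, and $\phi(x)=\mathbb E_{d\sim D}[l(x,d)]$. Assume that $\phi$ is bounded below and differentiable with $L$-Lipschitz gradient, that $\mathrm{Var}_{d\sim D}[l(x,d)]\le\sigma_f^2$ (finite second moment), $\mathbb E_{d\sim D}[\nabla_x l(x,d)]=\nabla\phi(x)$ and $\mathbb E_{d\sim D}\|\nabla_x l(x,d)-\nabla\phi(x)\|^2\le M_c+M_v\|\nabla\phi(x)\|^2$ for all $x$, where $\sigma_f,M_c,M_v\ge 0$. For an i.i.d. minibatch $S$ put $f(x,S)=\frac1{|S|}\sum_{d\in S}l(x,d)$ and $g(x,S)=\frac1{|S|}\sum_{d\in S}\nabla_xl(x,d)$. *Algorithm.* SASS has parameters $\theta,\gamma\in(0,1)$, $r>0$, $\alpha_{\max}\in(0,\infty]$, $\alpha_0\in(0,\alpha_{\max}]$, $x_0\in\mathbb R^m$. At iteration $k=0,1,\dots$ it draws a fresh minibatch of size $N_1(\alpha_k)$, which gives $g_k=g(x_k,\cdot)$,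 sets $s_k=-\alpha_kH_k^{-1}g_k$, where $H_k$ is a symmetric matrix with spectrum in $[h_1,h_2]$, $0<h_1\le h_2$, determined by the samples of earlier iterations (for instance the identity), and draws two fresh minibatches of size $N_0$, which give estimates $f_k^0$ of $\phi(x_k)$ and $f_k^+$ of $\phi(x_k+s_k)$. If $f_k^0-f_k^+\ge-\theta g_k^{T}s_k-r$, then $x_{k+1}=x_k+s_k$ and $\alpha_{k+1}=\min\{\gamma^{-1}\alpha_k,\alpha_{\max}\}$; otherwise $x_{k+1}=x_k$ and $\alpha_{k+1}=\gamma\alpha_k$. All samples are independent. *Oracles.* Let $\kappa,\tau>0$. The zeroth-order oracle satisfies SS.0 with $(\epsilon_f,\delta_0(\cdot))$ if $\mathbb P(|\phi(x)-f(x,S)|<\epsilon_f+t)\ge1-\delta_0(t)$ for all $x$ and $t>0$, $|S|=N_0$. The first-order oracle satisfies SS.1 with $(\epsilon_g,\delta_1)$ if $\mathbb P(\|g(x,S)-\nabla\phi(x)\|\le\max\{\epsilon_g,\min\{\tau,\kappa\alpha\}\|g(x,S)\|\})\ge1-\delta_1$ for all $x$ and $\alpha>0$, $|S|=N_1(\alpha)$.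 *Stopping time and cost.* For $\varepsilon>0$ let $T_\varepsilon=\min\{k:\|\nabla\phi(x_k)\|\le\varepsilon\}$ in the non-convex case, and $T_\varepsilon=\min\{k:\phi(x_k)-\inf\phi\le\varepsilon\}$ in the strongly convex case, in which $\phi$ is assumed $\mu$-strongly convex with $\mu>0$. Let $\mathsf{TOC}(n)=\sum_{k=1}^n(2N_0+N_1(\alpha_k))$. *Constants.* Fix $\bar\delta_0,\delta_1>0$ with $p:=1-2\bar\delta_0-\delta_1>\frac12$, $q:=1-p$, and $\rho>0$, $\eta\in(0,1)$ with $\frac{\eta}{1-\eta}\sqrt{h_2/h_1}<1-\theta$. Put $\epsilon_g=\eta\varepsilon$ in the non-convex and $\epsilon_g=\eta\sqrt{2\mu\varepsilon}$ in the strongly convex case. Then there is a constant $a>0$, depending only on $L,\mu,\theta,\alpha_0,h_1,h_2,\kappa,\tau,\eta,\rho,\bar\delta_0,\delta_1$, and for every $K>0$ a constant $C$, depending only on these, $a$ and $K$ (not on $m,D,l,\sigma_f,M_c,M_v,\varepsilon,n,\gamma$ or the other data), such that the following holds. 1. (Oracles.) Non-convex case: if $N_0\ge\max\{1,a\sigma_f^2/\varepsilon^4\}$,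 then SS.0 holds with $\epsilon_f=\rho\varepsilon^2$ and $\delta_0(\cdot)\equiv\bar\delta_0$; if $N_1(\alpha)\ge\max\{1,a(M_c/\varepsilon^2+M_v/\min\{\tau,\kappa\alpha\}^2)\}$ for all $\alpha>0$, then SS.1 holds with $(\epsilon_g,\delta_1)$. Strongly convex case: the same with $\varepsilon^4$, $\varepsilon^2$ replaced by $\varepsilon^2$, $\varepsilon$ (also in $\epsilon_f$). 2. (Complexity.) Let SS.0 hold with some $\epsilon_f\ge0$ and $\delta_0(\cdot)$ such that $r>2\epsilon_f$ and $\delta_0(r/2-\epsilon_f)\le\bar\delta_0$, let SS.1 hold with $(\epsilon_g,\delta_1)$, let $n\ge2$ be an integer and $(2q)^{1/2}<\gamma<1$. Non-convex case: if $N_0\le K\sigma_f^2/\varepsilon^4$ and $N_1(\alpha)\le K(M_c/\varepsilon^2+M_v/\min\{\tau,\kappa\alpha\}^2)$ for all $\alpha>0$, then $\mathsf{TOC}(\min\{T_\varepsilon,n\})$ is integrable and $$\mathbb E[\mathsf{TOC}(\min\{T_\varepsilon,n\})]\le C\Big(\frac{\sigma_f^2}{\varepsilon^4}n+\frac{M_c}{\varepsilon^2}n+M_v\,n\,n^{\log_{p/q}(1/\gamma^2)}\log_{p/q}(n)\Big);$$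 if moreover $\gamma\ge(q/p)^{\frac{\log c}{2\log n}}$ for some $c>1$, then $$\mathbb E[\mathsf{TOC}(\min\{T_\varepsilon,n\})]\le C\,n\Big(\frac{\sigma_f^2}{\varepsilon^4}+\frac{M_c}{\varepsilon^2}+M_v\log n\Big).$$ Strongly convex case: if $N_0\le K\sigma_f^2/\varepsilon^2$ and $N_1(\alpha)\le K(M_c/\varepsilon+M_v/\min\{\tau,\kappa\alpha\}^2)$ for all $\alpha>0$, then the same two bounds hold with $\varepsilon^4$ and $\varepsilon^2$ replaced by $\varepsilon^2$ and $\varepsilon$. -/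

import Mathlib

open MeasureTheory ProbabilityTheory
open scoped NNReal ENNReal Gradient RealInnerProductSpace

universe u v

noncomputable section

/-- The expected risk `φ(x) = 𝔼_{d ∼ D} [l(x, d)]`. -/
def risk {m : ℕ} {𝒟 : Type*} [MeasurableSpace 𝒟] (D : Measure 𝒟)
    (l : EuclideanSpace ℝ (Fin m) → 𝒟 → ℝ) (x : EuclideanSpace ℝ (Fin m)) : ℝ :=
  ∫ d, l x d ∂D

/-- Standing assumptions of expected risk minimization: the risk is well defined, `L`-smooth and
bounded below, the loss has variance at most `σf ^ 2`, and its gradient is an unbiased estimate of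
`∇ φ` whose mean squared error is at most `Mc + Mv ‖∇ φ(x)‖²`. -/
structure ERMAssumptions {m : ℕ} {𝒟 : Type*} [MeasurableSpace 𝒟] (D : Measure 𝒟)
    (l : EuclideanSpace ℝ (Fin m) → 𝒟 → ℝ) (L : ℝ≥0) (σf Mc Mv : ℝ) : Prop where
  measurable_loss : Measurable (Function.uncurry l)
  differentiable_loss : ∀ d, Differentiable ℝ (fun x => l x d)
  memLp_loss : ∀ x, MemLp (l x) 2 D
  variance_loss : ∀ x, Var[l x; D] ≤ σf ^ 2
  differentiable_risk : Differentiable ℝ (risk D l)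
  lipschitz_gradient : LipschitzWith L (∇ (risk D l))
  bddBelow_risk : BddBelow (Set.range (risk D l))
  integrable_gradient : ∀ x, Integrable (fun d => ∇ (fun y => l y d) x) D
  mean_gradient : ∀ x, ∫ d, ∇ (fun y => l y d) x ∂D = ∇ (risk D l) x
  integrable_sq_error : ∀ x, Integrable (fun d => ‖∇ (fun y => l y d) x - ∇ (risk D l) x‖ ^ 2) D
  mean_sq_error : ∀ x, ∫ d, ‖∇ (fun y => l y d) x - ∇ (risk D l) x‖ ^ 2 ∂D
    ≤ Mc + Mv * ‖∇ (risk D l) x‖ ^ 2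

/-- Minibatch function estimate `f(x, S) = |S|⁻¹ ∑_{d ∈ S} l(x, d)`. -/
def batchValue {m : ℕ} {𝒟 : Type*} (l : EuclideanSpace ℝ (Fin m) → 𝒟 → ℝ) {N : ℕ}
    (S : Fin N → 𝒟) (x : EuclideanSpace ℝ (Fin m)) : ℝ :=
  (N : ℝ)⁻¹ * ∑ i, l x (S i)

/-- Minibatch gradient estimate `g(x, S) = |S|⁻¹ ∑_{d ∈ S} ∇ₓ l(x, d)`. -/
def batchGrad {m : ℕ} {𝒟 : Type*} (l : EuclideanSpace ℝ (Fin m) → 𝒟 → ℝ) {N : ℕ}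
    (S : Fin N → 𝒟) (x : EuclideanSpace ℝ (Fin m)) : EuclideanSpace ℝ (Fin m) :=
  (N : ℝ)⁻¹ • ∑ i, ∇ (fun y => l y (S i)) x

/-- SS.0, the step search zeroth-order oracle condition, for i.i.d. minibatches of size `N₀`. -/
def SS0 {m : ℕ} {𝒟 : Type*} [MeasurableSpace 𝒟] (D : Measure 𝒟)
    (l : EuclideanSpace ℝ (Fin m) → 𝒟 → ℝ) (N₀ : ℕ) (εf : ℝ) (δ₀ : ℝ → ℝ) : Prop :=
  ∀ x, ∀ t > 0, 1 - δ₀ t ≤ (Measure.pi fun _ : Fin N₀ => D).real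
    {S | |risk D l x - batchValue l S x| < εf + t}

/-- SS.1, the step search first-order oracle condition, for i.i.d. minibatches of size `N₁ α`. -/
def SS1 {m : ℕ} {𝒟 : Type*} [MeasurableSpace 𝒟] (D : Measure 𝒟)
    (l : EuclideanSpace ℝ (Fin m) → 𝒟 → ℝ) (N₁ : ℝ → ℕ) (εg τ κ δ₁ : ℝ) : Prop :=
  ∀ x, ∀ α > 0, 1 - δ₁ ≤ (Measure.pi fun _ : Fin (N₁ α) => D).real
    {S | ‖batchGrad l S x - ∇ (risk D l) x‖ ≤ max εg (min τ (κ * α) * ‖batchGrad l S x‖)}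

/-- One iteration of SASS from the state `s = (x, α)`. The streams `d 0`, `d 1`, `d 2` provide the
fresh samples for the estimate of `φ(x)`, the estimate of `φ(x⁺)` and the gradient estimate. The
maximal step size `αmax` may be infinite. -/
def sassStep {m : ℕ} {𝒟 : Type*} (l : EuclideanSpace ℝ (Fin m) → 𝒟 → ℝ) (θ γ r : ℝ)
    (αmax : ℝ≥0∞) (N₀ : ℕ) (N₁ : ℝ → ℕ) (H : Matrix (Fin m) (Fin m) ℝ) (d : Fin 3 → ℕ → 𝒟)
    (s : EuclideanSpace ℝ (Fin m) × ℝ) : EuclideanSpace ℝ (Fin m) × ℝ :=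
  let x := s.1
  let α := s.2
  let g := batchGrad l (fun i : Fin (N₁ α) => d 2 i) x
  let step := -(α • Matrix.toEuclideanLin H⁻¹ g)
  let f := batchValue l (fun i : Fin N₀ => d 0 i) x
  let fplus := batchValue l (fun i : Fin N₀ => d 1 i) (x + step)
  if f - fplus ≥ -θ * ⟪g, step⟫ - r then
    (x + step, (min (ENNReal.ofReal (γ⁻¹ * α)) αmax).toReal)
  else
    (x, γ * α)

/-- The states `(x_k, α_k)` of SASS along one realization of the samples and of the matrices. -/
def sassPath {m : ℕ} {𝒟 : Type*} (l : EuclideanSpace ℝ (Fin m) → 𝒟 → ℝ) (θ γ r : ℝ)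
    (αmax : ℝ≥0∞) (N₀ : ℕ) (N₁ : ℝ → ℕ) (x₀ : EuclideanSpace ℝ (Fin m)) (α₀ : ℝ)
    (H : ℕ → Matrix (Fin m) (Fin m) ℝ) (d : ℕ → Fin 3 → ℕ → 𝒟) :
    ℕ → EuclideanSpace ℝ (Fin m) × ℝ
  | 0 => (x₀, α₀)
  | k + 1 => sassStep l θ γ r αmax N₀ N₁ (H k) (d k)
      (sassPath l θ γ r αmax N₀ N₁ x₀ α₀ H d k)

/-- The `σ`-algebra generated by the samples of the iterations `0, …, k - 1`. -/
abbrev pastSamples {𝒟 Ω : Type*} [MeasurableSpace 𝒟] (d : ℕ → Fin 3 → ℕ → Ω → 𝒟) (k : ℕ) :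
    MeasurableSpace Ω :=
  ⨆ (i : ℕ) (_ : i < k) (j : Fin 3) (t : ℕ), MeasurableSpace.comap (d i j t) inferInstance

/-- The random ingredients of a run: all samples are i.i.d. with law `D`, and `H k` is a symmetric
matrix, with spectrum in `[h₁, h₂]`, that is determined by the samples of the earlier
iterations. -/
structure SASSRandomness {m : ℕ} {𝒟 Ω : Type*} [MeasurableSpace 𝒟] [MeasurableSpace Ω]
    (D : Measure 𝒟) (P : Measure Ω) (h₁ h₂ : ℝ) (d : ℕ → Fin 3 → ℕ → Ω → 𝒟)
    (H : ℕ → Ω → Matrix (Fin m) (Fin m) ℝ) : Prop where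
  measurable_sample : ∀ k j i, Measurable (d k j i)
  law_sample : ∀ k j i, P.map (d k j i) = D
  indep_sample : iIndepFun (fun a : ℕ × Fin 3 × ℕ => d a.1 a.2.1 a.2.2) P
  adapted : ∀ k a b, Measurable[pastSamples d k] (fun ω => H k ω a b)
  posDef : ∀ k ω, (H k ω).PosDef
  lower : ∀ k ω (v : EuclideanSpace ℝ (Fin m)),
    h₁ * ‖v‖ ^ 2 ≤ ⟪v, Matrix.toEuclideanLin (H k ω) v⟫
  upper : ∀ k ω (v : EuclideanSpace ℝ (Fin m)),
    ⟪v, Matrix.toEuclideanLin (H k ω) v⟫ ≤ h₂ * ‖v‖ ^ 2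

/-- The first index at which `Q` holds, and `⊤` if there is none. -/
def firstTime (Q : ℕ → Prop) : ℕ∞ := ⨅ (k : ℕ) (_ : Q k), (k : ℕ∞)

/-- `TOC(n) = ∑_{k=1}^n oc(α_k)`, where an iteration with step size parameter `α` draws two
minibatches of size `N₀` for function values and one of size `N₁ α` for the gradient. -/
def totalCost (N₀ : ℕ) (N₁ : ℝ → ℕ) (α : ℕ → ℝ) (n : ℕ) : ℝ :=
  ∑ k ∈ Finset.Icc 1 n, ((N₀ : ℝ) + (N₀ : ℝ) + (N₁ (α k) : ℝ))

/-- `TOC(min {T_ε, n})` in the non-convex case, `T_ε = min {k : ‖∇ φ(x_k)‖ ≤ ε}`. -/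
def tocNonconvex {m : ℕ} (φ : EuclideanSpace ℝ (Fin m) → ℝ) (ε : ℝ) (N₀ : ℕ) (N₁ : ℝ → ℕ)
    (x : ℕ → EuclideanSpace ℝ (Fin m)) (α : ℕ → ℝ) (n : ℕ) : ℝ :=
  totalCost N₀ N₁ α (min (firstTime fun k => ‖∇ φ (x k)‖ ≤ ε) n).toNat

/-- `TOC(min {T_ε, n})` in the strongly convex case, `T_ε = min {k : φ(x_k) - inf φ ≤ ε}`. -/
def tocStronglyConvex {m : ℕ} (φ : EuclideanSpace ℝ (Fin m) → ℝ) (ε : ℝ) (N₀ : ℕ) (N₁ : ℝ → ℕ)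
    (x : ℕ → EuclideanSpace ℝ (Fin m)) (α : ℕ → ℝ) (n : ℕ) : ℝ :=
  totalCost N₀ N₁ α (min (firstTime fun k => φ (x k) - (⨅ y, φ y) ≤ ε) n).toNat

end

/-! The oracle statements are Chebyshev and Markov bounds: averaging an i.i.d. minibatch divides the
variance by its size.

The complexity bound rests on a Lyapunov function of the step size. There is a threshold `β`, fixed
by the problem constants, such that whenever `α ≤ β`, the gradient is large and the three estimates
of the iteration are accurate, the trial step is accepted (`sufficient_decrease`). Put `W = max {(β
/ α)², 1}`. An accurate iteration before the stopping time gives `W' ≤ γ² W + (1/γ² - γ²)`, and any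
iteration gives `W' ≤ W / γ²` (`stepPenalty_sassStep_le`). The samples are fresh, so each inaccuracy
event carries at most its own failure probability's share of the expectation of `W`, because `W`
depends on the past only (`setIntegral_le_of_indepFun`). The three shares add up to `q = 2 δ₀ + δ₁`.
As `γ² > 2 q`, the resulting recursion for the expectation of `W`, restricted to runs not yet
stopped, preserves the bound `2 / (q (2 p - 1))`, which is free of `k` and `γ`
(`integral_le_of_drift`, `drift_bound`).

A gradient minibatch costs at most a constant plus a multiple of `W`, so the expected cost is at
most linear in `n`. This is stronger than both claimed bounds: for `n ≥ 2` their logarithmic factors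
are bounded below by a positive constant, which is absorbed in `C`. The strongly convex case is the
same argument with gradient threshold `√(2 μ ε)`, by the Polyak-Łojasiewicz inequality. -/

/-! ### Deterministic inequalities for smooth and strongly convex functions -/

/-- The descent inequality for a function with Lipschitz gradient. -/
theorem le_add_inner_gradient_add_sq {E : Type*} [NormedAddCommGroup E] [InnerProductSpace ℝ E]
    [CompleteSpace E] {f : E → ℝ} {L : ℝ≥0} (hf : Differentiable ℝ f)
    (hL : LipschitzWith L (∇ f)) (x v : E) :
    f (x + v) ≤ f x + ⟪∇ f x, v⟫ + L / 2 * ‖v‖ ^ 2 := by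
  let h : ℝ → ℝ := fun t => f (x + t • v) - t * ⟪∇ f x, v⟫ - L / 2 * t ^ 2 * ‖v‖ ^ 2
  have hd : ∀ t, HasDerivAt h (⟪∇ f (x + t • v), v⟫ - ⟪∇ f x, v⟫ - L * t * ‖v‖ ^ 2) t := by
    intro t
    have h1 : HasDerivAt (fun t : ℝ => x + t • v) v t := by
      simpa using ((hasDerivAt_id t).smul_const v).const_add x
    have h2 := (hf (x + t • v)).hasGradientAt.hasFDerivAt.comp_hasDerivAt t h1
    have h3 : HasDerivAt (fun t : ℝ => t * ⟪∇ f x, v⟫) ⟪∇ f x, v⟫ t := by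
      simpa using (hasDerivAt_id t).mul_const ⟪∇ f x, v⟫
    have h4 : HasDerivAt (fun t : ℝ => L / 2 * t ^ 2 * ‖v‖ ^ 2) (L * t * ‖v‖ ^ 2) t := by
      refine (((hasDerivAt_pow 2 t).const_mul ((L : ℝ) / 2)).mul_const (‖v‖ ^ 2)).congr_deriv ?_
      rw [Nat.cast_ofNat]
      ring
    exact (h2.sub h3).sub h4
  have hanti : AntitoneOn h (Set.Icc 0 1) := by
    refine antitoneOn_of_hasDerivWithinAt_nonpos (convex_Icc 0 1)
      (fun t _ => (hd t).continuousAt.continuousWithinAt) (fun t _ => (hd t).hasDerivWithinAt) ?_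
    intro t ht
    rw [interior_Icc] at ht
    rw [← inner_sub_left]
    have h1 : ‖∇ f (x + t • v) - ∇ f x‖ ≤ L * (t * ‖v‖) := by
      have := hL.dist_le_mul (x + t • v) x
      rw [dist_eq_norm, dist_eq_norm, add_sub_cancel_left, norm_smul, Real.norm_eq_abs,
        abs_of_pos ht.1] at this
      exact this
    have h2 := real_inner_le_norm (∇ f (x + t • v) - ∇ f x) v
    have h3 := mul_le_mul_of_nonneg_right h1 (norm_nonneg v)
    linarith
  have := hanti (by simp) (by simp) zero_le_one
  simp only [h, one_smul, zero_smul, add_zero] at this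
  linarith

/-- The Polyak-Łojasiewicz inequality for a differentiable strongly convex function. -/
theorem StrongConvexOn.sub_le_norm_gradient_sq {E : Type*} [NormedAddCommGroup E]
    [InnerProductSpace ℝ E] [CompleteSpace E] {f : E → ℝ} {μ : ℝ} (hμ : 0 < μ)
    (hf : Differentiable ℝ f) (hc : StrongConvexOn Set.univ μ f) (x y : E) :
    2 * μ * (f x - f y) ≤ ‖∇ f x‖ ^ 2 := by
  set v := y - x
  have h1 : HasDerivAt (fun t : ℝ => x + t • v) v 0 := by
    simpa using ((hasDerivAt_id (0 : ℝ)).smul_const v).const_add x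
  have h2 : HasDerivAt (fun t : ℝ => f (x + t • v)) ⟪∇ f x, v⟫ 0 := by
    have h0 : HasFDerivAt f (InnerProductSpace.toDual ℝ E (∇ f x)) (x + (0 : ℝ) • v) := by
      simpa using (hf x).hasGradientAt.hasFDerivAt
    exact h0.comp_hasDerivAt (0 : ℝ) h1
  have h3 : ⟪∇ f x, v⟫ ≤ f y - f x - μ / 2 * ‖v‖ ^ 2 := by
    -- Strong convexity bounds the difference quotient at `t` by this function; letting `t` decrease
    -- to `0` bounds the directional derivative.
    have hr : Filter.Tendsto (fun t : ℝ => f y - f x - (1 - t) * (μ / 2 * ‖v‖ ^ 2))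
        (nhdsWithin 0 (Set.Ioi 0)) (nhds (f y - f x - (1 - 0) * (μ / 2 * ‖v‖ ^ 2))) :=
      Filter.Tendsto.mono_left (Continuous.tendsto (by fun_prop) _) nhdsWithin_le_nhds
    rw [sub_zero, one_mul] at hr
    refine le_of_tendsto_of_tendsto h2.tendsto_slope_zero_right hr ?_
    filter_upwards [Ioo_mem_nhdsGT (zero_lt_one (α := ℝ))] with t ht
    have := hc.2 (Set.mem_univ x) (Set.mem_univ y) (sub_nonneg.2 ht.2.le) ht.1.le (by ring)
    have e : (1 - t) • x + t • y = x + t • v := by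
      simp only [v, smul_sub, sub_smul, one_smul]; abel
    rw [e, norm_sub_rev x y] at this
    simp only [smul_eq_mul, zero_add, zero_smul, add_zero] at this ⊢
    rw [inv_mul_le_iff₀ ht.1]
    change _ ≤ _ - _ * (μ / 2 * ‖v‖ ^ 2) at this
    linarith
  have h4 := neg_le_of_abs_le (abs_real_inner_le_norm (∇ f x) v)
  nlinarith [sq_nonneg (‖∇ f x‖ - μ * ‖v‖)]

/-- If `h₁ ≤ H ≤ h₂` and `y = H⁻¹ g`, then `h₁ ‖y‖² ≤ ⟪y, g⟫` and `‖g‖² ≤ h₂ ⟪y, g⟫`. -/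
theorem Matrix.PosDef.inv_bounds {m : ℕ} {H : Matrix (Fin m) (Fin m) ℝ} (hH : H.PosDef)
    {h₁ h₂ : ℝ} (hh₂ : 0 < h₂)
    (lower : ∀ v : EuclideanSpace ℝ (Fin m), h₁ * ‖v‖ ^ 2 ≤ ⟪v, Matrix.toEuclideanLin H v⟫)
    (upper : ∀ v : EuclideanSpace ℝ (Fin m), ⟪v, Matrix.toEuclideanLin H v⟫ ≤ h₂ * ‖v‖ ^ 2)
    (g : EuclideanSpace ℝ (Fin m)) :
    h₁ * ‖Matrix.toEuclideanLin H⁻¹ g‖ ^ 2 ≤ ⟪Matrix.toEuclideanLin H⁻¹ g, g⟫ ∧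
      ‖g‖ ^ 2 ≤ h₂ * ⟪Matrix.toEuclideanLin H⁻¹ g, g⟫ := by
  set y := Matrix.toEuclideanLin H⁻¹ g with hy
  have hg : Matrix.toEuclideanLin H y = g := by
    have hu : IsUnit H.det := hH.det_pos.ne'.isUnit
    rw [hy]
    apply (WithLp.ofLp_injective 2)
    simp [Matrix.toLpLin_apply, Matrix.mulVec_mulVec, Matrix.mul_nonsing_inv _ hu]
  have hsym := Matrix.isSymmetric_toEuclideanLin_iff.2 hH.1
  have hnn : ∀ v : EuclideanSpace ℝ (Fin m), 0 ≤ ⟪v, Matrix.toEuclideanLin H v⟫ := by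
    intro v
    have := hH.posSemidef.re_dotProduct_nonneg v.ofLp
    simpa [Matrix.toLpLin_apply, EuclideanSpace.inner_eq_star_dotProduct, dotProduct_comm]
      using this
  refine ⟨by simpa only [hg] using lower y, ?_⟩
  -- Since `H y = g`, expanding the quadratic form of `H` at `y - h₂⁻¹ g` leaves `⟪y, g⟫ - 2 h₂⁻¹
  -- ‖g‖² + h₂⁻² ⟪g, H g⟫ ≥ 0`, and `H ≤ h₂` bounds the last term by `h₂⁻¹ ‖g‖²`.
  have h1 := hnn (y - h₂⁻¹ • g)
  have h2 := upper g
  have h3 : ⟪y, Matrix.toEuclideanLin H g⟫ = ‖g‖ ^ 2 := by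
    rw [← hsym y g, hg, real_inner_self_eq_norm_sq]
  rw [map_sub, map_smul, hg, inner_sub_left, inner_sub_right, inner_sub_right,
    real_inner_smul_left, real_inner_smul_left, real_inner_smul_right, real_inner_smul_right,
    h3, real_inner_self_eq_norm_sq] at h1
  have h4 : h₂⁻¹ * (h₂⁻¹ * ⟪g, Matrix.toEuclideanLin H g⟫) ≤ h₂⁻¹ * ‖g‖ ^ 2 := by
    calc _ ≤ h₂⁻¹ * (h₂⁻¹ * (h₂ * ‖g‖ ^ 2)) := by gcongr
      _ = _ := by field_simp
  have h5 : h₂⁻¹ * ‖g‖ ^ 2 ≤ ⟪y, g⟫ := by linarith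
  rwa [inv_mul_le_iff₀ hh₂] at h5

/-- A step `-α y` along a gradient estimate `g` with small relative error achieves the decrease
required by the step search, if the step size parameter is small. -/
theorem sufficient_decrease {E : Type*} [NormedAddCommGroup E] [InnerProductSpace ℝ E]
    [CompleteSpace E] {f : E → ℝ} {L : ℝ≥0} (hf : Differentiable ℝ f)
    (hL : LipschitzWith L (∇ f)) {θ h₁ h₂ α e : ℝ} (hh₁ : 0 < h₁) (hh₂ : 0 < h₂) (hα : 0 ≤ α)
    (he : 0 ≤ e) (hbound : e * √(h₂ / h₁) + L * α / (2 * h₁) ≤ 1 - θ) {x g y : E}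
    (hg : ‖g - ∇ f x‖ ≤ e * ‖g‖) (h1 : h₁ * ‖y‖ ^ 2 ≤ ⟪y, g⟫) (h2 : ‖g‖ ^ 2 ≤ h₂ * ⟪y, g⟫) :
    f (x + -(α • y)) ≤ f x + θ * ⟪g, -(α • y)⟫ := by
  have hd := le_add_inner_gradient_add_sq hf hL x (-(α • y))
  rw [inner_neg_right, real_inner_smul_right, norm_neg, norm_smul, Real.norm_eq_abs,
    abs_of_nonneg hα] at hd
  rw [inner_neg_right, real_inner_smul_right, real_inner_comm]
  set a := ⟪y, g⟫ with ha
  have ha0 : 0 ≤ a := le_trans (by positivity) h1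
  -- Multiplying the two spectral bounds measures the gradient error in units of `⟪y, g⟫`; this is
  -- where `√(h₂ / h₁)` comes from.
  have hgy : ‖g‖ * ‖y‖ ≤ √(h₂ / h₁) * a := by
    apply le_of_sq_le_sq _ (by positivity)
    rw [mul_pow, mul_pow, Real.sq_sqrt (by positivity)]
    have : ‖y‖ ^ 2 ≤ a / h₁ := by rw [le_div_iff₀ hh₁]; linarith
    calc ‖g‖ ^ 2 * ‖y‖ ^ 2 ≤ (h₂ * a) * (a / h₁) := by gcongr
      _ = _ := by ring
  have hin : a - ⟪∇ f x, y⟫ ≤ e * (√(h₂ / h₁) * a) := by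
    rw [ha, real_inner_comm, ← inner_sub_left]
    calc _ ≤ ‖g - ∇ f x‖ * ‖y‖ := real_inner_le_norm _ _
      _ ≤ e * ‖g‖ * ‖y‖ := by gcongr
      _ = e * (‖g‖ * ‖y‖) := by ring
      _ ≤ e * (√(h₂ / h₁) * a) := by gcongr
      _ = _ := by rw [ha, real_inner_comm]
  have hy : L / 2 * (α * ‖y‖) ^ 2 ≤ α * (L * α / (2 * h₁) * a) := by
    have : ‖y‖ ^ 2 ≤ a / h₁ := by rw [le_div_iff₀ hh₁]; linarith
    calc L / 2 * (α * ‖y‖) ^ 2 = L / 2 * α ^ 2 * ‖y‖ ^ 2 := by ring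
      _ ≤ L / 2 * α ^ 2 * (a / h₁) := by gcongr
      _ = _ := by field_simp
  have h5 := mul_le_mul_of_nonneg_left (mul_le_mul_of_nonneg_right hbound ha0) hα
  have h6 := mul_le_mul_of_nonneg_left hin hα
  nlinarith

/-! ### Measurability of the minibatch estimates and of the inverse matrix -/

/-- Each coordinate of the gradient is the pointwise limit of difference quotients with increments
`1 / (n + 1)`, which are jointly measurable. -/
theorem measurable_gradient_uncurry {m : ℕ} {𝒟 : Type*} [MeasurableSpace 𝒟]
    {l : EuclideanSpace ℝ (Fin m) → 𝒟 → ℝ} (hl : Measurable (Function.uncurry l))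
    (hd : ∀ d, Differentiable ℝ (fun x => l x d)) :
    Measurable (fun p : EuclideanSpace ℝ (Fin m) × 𝒟 => ∇ (fun y => l y p.2) p.1) := by
  suffices h : ∀ i, Measurable (fun p : EuclideanSpace ℝ (Fin m) × 𝒟 =>
      (∇ (fun y => l y p.2) p.1) i) from
    (WithLp.measurable_toLp 2 (Fin m → ℝ)).comp (measurable_pi_iff.2 h)
  intro i
  set e : EuclideanSpace ℝ (Fin m) := EuclideanSpace.single i 1
  refine measurable_of_tendsto_metrizable (f := fun (n : ℕ) p =>
    ((1 : ℝ) / (n + 1))⁻¹ * (l (p.1 + ((1 : ℝ) / (n + 1)) • e) p.2 - l p.1 p.2)) ?_ ?_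
  · intro n
    have h1 : Measurable (fun p : EuclideanSpace ℝ (Fin m) × 𝒟 =>
        l (p.1 + ((1 : ℝ) / (n + 1)) • e) p.2) :=
      hl.comp ((measurable_fst.add_const _).prodMk measurable_snd)
    exact (h1.sub hl).const_mul _
  · rw [tendsto_pi_nhds]
    rintro ⟨x, d⟩
    have h1 : HasDerivAt (fun t : ℝ => x + t • e) e 0 := by
      simpa using ((hasDerivAt_id (0 : ℝ)).smul_const e).const_add x
    have h0 : HasFDerivAt (fun y => l y d)
        (InnerProductSpace.toDual ℝ _ (∇ (fun y => l y d) x)) (x + (0 : ℝ) • e) := by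
      simpa using (hd d x).hasGradientAt.hasFDerivAt
    have h2 : HasDerivAt (fun t : ℝ => l (x + t • e) d) ⟪∇ (fun y => l y d) x, e⟫ 0 := by
      have := h0.comp_hasDerivAt (0 : ℝ) h1
      exact this
    have h3 := h2.tendsto_slope_zero.comp (tendsto_nhdsWithin_iff.2
      ⟨tendsto_one_div_add_atTop_nhds_zero_nat (𝕜 := ℝ),
        Filter.Eventually.of_forall fun n => (Nat.one_div_pos_of_nat (α := ℝ)).ne'⟩)
    have h4 : ⟪∇ (fun y => l y d) x, e⟫ = (∇ (fun y => l y d) x) i := by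
      simp [e, EuclideanSpace.inner_single_right, -inner_gradient_left]
    rw [h4] at h3
    simpa [Function.comp_def] using h3

theorem measurable_batchValue {m : ℕ} {𝒟 : Type*} [MeasurableSpace 𝒟]
    {l : EuclideanSpace ℝ (Fin m) → 𝒟 → ℝ} (hl : Measurable (Function.uncurry l)) (N : ℕ) :
    Measurable (fun p : EuclideanSpace ℝ (Fin m) × (Fin N → 𝒟) => batchValue l p.2 p.1) := by
  unfold batchValue
  refine Measurable.const_mul (Finset.measurable_sum _ fun i _ => ?_) _
  exact hl.comp (measurable_fst.prodMk ((measurable_pi_apply i).comp measurable_snd))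

theorem measurable_batchGrad {m : ℕ} {𝒟 : Type*} [MeasurableSpace 𝒟]
    {l : EuclideanSpace ℝ (Fin m) → 𝒟 → ℝ} (hl : Measurable (Function.uncurry l))
    (hd : ∀ d, Differentiable ℝ (fun x => l x d)) (N : ℕ) :
    Measurable (fun p : EuclideanSpace ℝ (Fin m) × (Fin N → 𝒟) => batchGrad l p.2 p.1) := by
  have h : Measurable (fun p : EuclideanSpace ℝ (Fin m) × (Fin N → 𝒟) =>
      ∑ i, ∇ (fun y => l y (p.2 i)) p.1) :=
    Finset.measurable_sum _ fun i _ => (measurable_gradient_uncurry hl hd).comp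
      (measurable_fst.prodMk ((measurable_pi_apply i).comp measurable_snd))
  exact h.const_smul (N : ℝ)⁻¹

/-- Joint measurability of the gradient estimate whose minibatch size depends on the state. -/
theorem measurable_batchGrad_size {m : ℕ} {𝒟 : Type*} [MeasurableSpace 𝒟]
    {l : EuclideanSpace ℝ (Fin m) → 𝒟 → ℝ} (hl : Measurable (Function.uncurry l))
    (hd : ∀ d, Differentiable ℝ (fun x => l x d)) {N₁ : ℝ → ℕ} (hN : Measurable N₁) :
    Measurable (fun p : (EuclideanSpace ℝ (Fin m) × ℝ) × (ℕ → 𝒟) =>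
      batchGrad l (fun i : Fin (N₁ p.1.2) => p.2 i) p.1.1) := by
  have h : Measurable (fun p : ℕ × (EuclideanSpace ℝ (Fin m) × (ℕ → 𝒟)) =>
      batchGrad l (fun i : Fin p.1 => p.2.2 i) p.2.1) := by
    -- The minibatch size takes countably many values, so it suffices to treat each fixed size.
    refine measurable_from_prod_countable_right fun N => ?_
    have hr : Measurable (fun y : EuclideanSpace ℝ (Fin m) × (ℕ → 𝒟) =>
        (y.1, fun i : Fin N => y.2 i)) := by fun_prop
    have := (measurable_batchGrad hl hd N).comp hr
    simpa only [Function.comp_def] using this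
  exact h.comp (f := fun p : (EuclideanSpace ℝ (Fin m) × ℝ) × (ℕ → 𝒟) =>
    (N₁ p.1.2, p.1.1, p.2)) (by fun_prop)

/-- By Cramer's rule an entry of the inverse is a quotient of two determinants, which are
polynomials in the entries. -/
theorem measurable_matrix_inv_apply {m : ℕ} {Ω : Type*} [MeasurableSpace Ω]
    {H : Ω → Matrix (Fin m) (Fin m) ℝ} (hH : ∀ a b, Measurable (fun ω => H ω a b)) (a b : Fin m) :
    Measurable (fun ω => (H ω)⁻¹ a b) := by
  have hdet : ∀ G : Ω → Matrix (Fin m) (Fin m) ℝ, (∀ a b, Measurable (fun ω => G ω a b)) →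
      Measurable (fun ω => (G ω).det) := by
    intro G hG
    simp only [Matrix.det_apply]
    exact Finset.measurable_sum _ fun σ _ => Measurable.const_smul
      (Finset.measurable_prod _ fun i _ => hG _ _) _
  simp only [Matrix.inv_def, Matrix.smul_apply, Ring.inverse_eq_inv', smul_eq_mul,
    Matrix.adjugate_apply]
  refine (hdet H hH).inv.mul (hdet _ fun i j => ?_)
  simp only [Matrix.updateRow_apply]
  split_ifs
  · exact measurable_const
  · exact hH i j

theorem measurable_toEuclideanLin_apply {m : ℕ} {Ω : Type*} [MeasurableSpace Ω]
    {H : Ω → Matrix (Fin m) (Fin m) ℝ} (hH : ∀ a b, Measurable (fun ω => H ω a b))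
    {g : Ω → EuclideanSpace ℝ (Fin m)} (hg : Measurable g) :
    Measurable (fun ω => Matrix.toEuclideanLin (H ω) (g ω)) := by
  refine (WithLp.measurable_toLp 2 (Fin m → ℝ)).comp (measurable_pi_iff.2 fun i => ?_)
  have h : Measurable (fun ω => ∑ j, H ω i j * g ω j) :=
    Finset.measurable_sum _ fun j _ => (hH i j).mul
      ((measurable_pi_apply j).comp ((WithLp.measurable_ofLp 2 (Fin m → ℝ)).comp hg))
  exact h

/-! ### Oracle conditions from minibatch sizes -/

/-- Moments of the mean of an i.i.d. sample. -/
theorem sampleMean_moments {𝒟 : Type*} [MeasurableSpace 𝒟] {D : Measure 𝒟}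
    [IsProbabilityMeasure D] {Y : 𝒟 → ℝ} (hY : MemLp Y 2 D) {N : ℕ} (hN : 1 ≤ N) :
    MemLp (fun S : Fin N → 𝒟 => (N : ℝ)⁻¹ * ∑ i, Y (S i)) 2 (Measure.pi fun _ => D) ∧
    ∫ S, (N : ℝ)⁻¹ * ∑ i, Y (S i) ∂(Measure.pi fun _ : Fin N => D) = ∫ d, Y d ∂D ∧
    Var[fun S : Fin N → 𝒟 => (N : ℝ)⁻¹ * ∑ i, Y (S i); Measure.pi fun _ => D]
      = Var[Y; D] / N := by
  have hN0 : (N : ℝ) ≠ 0 := by positivity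
  have hm : ∀ i : Fin N, MemLp (fun S : Fin N → 𝒟 => Y (S i)) 2 (Measure.pi fun _ => D) :=
    fun i => hY.comp_measurePreserving (measurePreserving_eval (fun _ : Fin N => D) i)
  refine ⟨(memLp_finsetSum _ fun i _ => hm i).const_mul _, ?_, ?_⟩
  · rw [integral_const_mul, integral_finsetSum _ fun i _ => (hm i).integrable one_le_two]
    have : ∀ i : Fin N, ∫ S : Fin N → 𝒟, Y (S i) ∂(Measure.pi fun _ => D) = ∫ d, Y d ∂D :=
      fun i => integral_comp_eval (μ := fun _ : Fin N => D) (i := i) hY.1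
    simp only [this, Finset.sum_const, Finset.card_univ, Fintype.card_fin, nsmul_eq_mul]
    field_simp
  · rw [variance_const_mul]
    have := variance_sum_pi (μ := fun _ : Fin N => D) (X := fun _ => Y) fun _ => hY
    rw [Finset.sum_fn] at this
    rw [this, Finset.sum_const, Finset.card_univ, Fintype.card_fin, nsmul_eq_mul]
    field_simp

/-- Chebyshev's inequality at tolerance `εf + t`. Since `εf + t > εf`, the failure bound for
tolerance `εf` serves every `t > 0`, so a constant `δ` is enough. -/
theorem SS0.of_le_size {m : ℕ} {𝒟 : Type*} [MeasurableSpace 𝒟] {D : Measure 𝒟}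
    [IsProbabilityMeasure D] {l : EuclideanSpace ℝ (Fin m) → 𝒟 → ℝ} {L : ℝ≥0} {σf Mc Mv : ℝ}
    (hA : ERMAssumptions D l L σf Mc Mv) {N₀ : ℕ} (hN : 1 ≤ N₀) {εf δ : ℝ} (hε : 0 < εf)
    (hsize : σf ^ 2 / εf ^ 2 ≤ δ * N₀) : SS0 D l N₀ εf (fun _ => δ) := by
  intro x t ht
  obtain ⟨h1, h2, h3⟩ := sampleMean_moments (hA.memLp_loss x) hN
  have hN0 : (0 : ℝ) < N₀ := by positivity
  have hc := meas_ge_le_variance_div_sq h1 (add_pos hε ht)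
  rw [h2, h3] at hc
  have hle : Var[l x; D] / N₀ / (εf + t) ^ 2 ≤ δ := by
    rw [div_div, div_le_iff₀ (by positivity)]
    rw [div_le_iff₀ (by positivity)] at hsize
    have hδ : 0 ≤ δ * N₀ := by
      by_contra h
      have : δ * N₀ * εf ^ 2 < 0 := mul_neg_of_neg_of_pos (not_le.1 h) (by positivity)
      nlinarith [sq_nonneg σf]
    calc _ ≤ σf ^ 2 := hA.variance_loss x
      _ ≤ δ * N₀ * εf ^ 2 := hsize
      _ ≤ δ * N₀ * (εf + t) ^ 2 := by gcongr; linarith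
      _ = _ := by ring
  have hmeas : MeasurableSet {S : Fin N₀ → 𝒟 | |risk D l x - batchValue l S x| < εf + t} :=
    measurableSet_lt (((measurable_batchValue hA.measurable_loss N₀).comp
      (measurable_const.prodMk measurable_id)).const_sub _).abs measurable_const
  have hcompl : {S : Fin N₀ → 𝒟 | |risk D l x - batchValue l S x| < εf + t}ᶜ
      = {S | εf + t ≤ |(N₀ : ℝ)⁻¹ * ∑ i, l x (S i) - ∫ d, l x d ∂D|} := by
    ext S
    simp only [Set.mem_compl_iff, Set.mem_ofPred_eq, not_lt, risk, batchValue, abs_sub_comm]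
  have hb : (Measure.pi fun _ : Fin N₀ => D).real
      {S : Fin N₀ → 𝒟 | |risk D l x - batchValue l S x| < εf + t}ᶜ ≤ δ := by
    rw [hcompl]
    refine ENNReal.toReal_le_of_le_ofReal ?_ (hc.trans (ENNReal.ofReal_le_ofReal hle))
    exact le_trans (div_nonneg (div_nonneg (variance_nonneg _ _) hN0.le) (sq_nonneg _)) hle
  rw [probReal_compl_eq_one_sub hmeas] at hb
  linarith

/-- The mean squared error of the minibatch gradient. -/
theorem ERMAssumptions.integral_sq_error_batchGrad {m : ℕ} {𝒟 : Type*} [MeasurableSpace 𝒟]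
    {D : Measure 𝒟} [IsProbabilityMeasure D] {l : EuclideanSpace ℝ (Fin m) → 𝒟 → ℝ} {L : ℝ≥0}
    {σf Mc Mv : ℝ} (hA : ERMAssumptions D l L σf Mc Mv) {N : ℕ} (hN : 1 ≤ N)
    (x : EuclideanSpace ℝ (Fin m)) :
    Integrable (fun S : Fin N → 𝒟 => ‖batchGrad l S x - ∇ (risk D l) x‖ ^ 2)
      (Measure.pi fun _ => D) ∧
    ∫ S, ‖batchGrad l S x - ∇ (risk D l) x‖ ^ 2 ∂(Measure.pi fun _ : Fin N => D)
      ≤ (Mc + Mv * ‖∇ (risk D l) x‖ ^ 2) / N := by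
  set G : 𝒟 → EuclideanSpace ℝ (Fin m) := fun d => ∇ (fun y => l y d) x with hG
  set g := ∇ (risk D l) x with hg
  have hGm : Measurable G := (measurable_gradient_uncurry hA.measurable_loss
    hA.differentiable_loss).comp (measurable_const.prodMk measurable_id)
  have hdiff : MemLp (fun d => G d - g) 2 D :=
    (memLp_two_iff_integrable_sq_norm (hGm.sub_const g).aestronglyMeasurable).2
      (hA.integrable_sq_error x)
  have hcoord : ∀ j, MemLp (fun d => G d j - g j) 2 D := fun j =>
    (EuclideanSpace.proj (𝕜 := ℝ) j).comp_memLp' hdiff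
  have hY : ∀ j, MemLp (fun d => G d j) 2 D := fun j => by
    have := (hcoord j).add (memLp_const (g j))
    simpa only [Pi.add_def, sub_add_cancel] using this
  have hmean : ∀ j, ∫ d, G d j ∂D = g j := fun j => by
    have := (EuclideanSpace.proj (𝕜 := ℝ) j).integral_comp_comm (hA.integrable_gradient x)
    rw [hA.mean_gradient x] at this
    exact this
  -- The squared norm splits into coordinates, and each coordinate is the variance of a scalar
  -- sample mean.
  have hexp : ∀ S : Fin N → 𝒟, ‖batchGrad l S x - g‖ ^ 2
      = ∑ j, ((N : ℝ)⁻¹ * ∑ i, G (S i) j - g j) ^ 2 := by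
    intro S
    rw [EuclideanSpace.norm_sq_eq]
    simp [batchGrad, hG]
  have hexp' : ∀ d, ‖G d - g‖ ^ 2 = ∑ j, (G d j - g j) ^ 2 := by
    intro d
    rw [EuclideanSpace.norm_sq_eq]
    simp
  have hmom := fun j => sampleMean_moments (hY j) hN
  have hint : ∀ j, Integrable (fun S : Fin N → 𝒟 => ((N : ℝ)⁻¹ * ∑ i, G (S i) j - g j) ^ 2)
      (Measure.pi fun _ => D) := fun j => ((hmom j).1.sub (memLp_const (g j))).integrable_sq
  have hvar : ∀ j, ∫ S, ((N : ℝ)⁻¹ * ∑ i, G (S i) j - g j) ^ 2 ∂(Measure.pi fun _ : Fin N => D)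
      = (∫ d, (G d j - g j) ^ 2 ∂D) / N := by
    intro j
    have h1 := variance_eq_integral (hmom j).1.aemeasurable
    have h2 := variance_eq_integral (hY j).aemeasurable
    rw [(hmom j).2.1, (hmom j).2.2, hmean j] at h1
    rw [hmean j] at h2
    rw [← h1, h2]
  simp only [hexp]
  refine ⟨integrable_finsetSum _ fun j _ => hint j, ?_⟩
  rw [integral_finsetSum _ fun j _ => hint j]
  simp only [hvar]
  rw [← Finset.sum_div, ← integral_finsetSum _ fun j _ => (hcoord j).integrable_sq]
  simp only [← hexp']
  gcongr
  exact hA.mean_sq_error x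

/-- Concentration of the minibatch gradient relative to its own norm. -/
theorem ERMAssumptions.le_measureReal_batchGrad {m : ℕ} {𝒟 : Type*} [MeasurableSpace 𝒟]
    {D : Measure 𝒟} [IsProbabilityMeasure D] {l : EuclideanSpace ℝ (Fin m) → 𝒟 → ℝ} {L : ℝ≥0}
    {σf Mc Mv : ℝ} (hA : ERMAssumptions D l L σf Mc Mv) (hMc : 0 ≤ Mc) (hMv : 0 ≤ Mv)
    {εg τ b δ : ℝ} (hε : 0 < εg) (hb0 : 0 < b) (hbτ : b ≤ τ) {N : ℕ} (hN : 1 ≤ N)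
    (hsize : 2 * (Mc / εg ^ 2 + (1 + τ) ^ 2 * (Mv / b ^ 2)) ≤ δ * N)
    (x : EuclideanSpace ℝ (Fin m)) :
    1 - δ ≤ (Measure.pi fun _ : Fin N => D).real
      {S | ‖batchGrad l S x - ∇ (risk D l) x‖ ≤ max εg (b * ‖batchGrad l S x‖)} := by
  have hN0 : (0 : ℝ) < N := by exact_mod_cast hN
  have hτ : 0 < τ := hb0.trans_le hbτ
  set g := ∇ (risk D l) x
  obtain ⟨hint, hle⟩ := hA.integral_sq_error_batchGrad hN x
  have hgm : Measurable (fun S : Fin N → 𝒟 => batchGrad l S x) := by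
    have hp : Measurable (fun S : Fin N → 𝒟 => (x, S)) := by fun_prop
    have := (measurable_batchGrad hA.measurable_loss hA.differentiable_loss N).comp hp
    simpa only [Function.comp_def] using this
  have hmeas : MeasurableSet {S : Fin N → 𝒟 | ‖batchGrad l S x - g‖
      ≤ max εg (b * ‖batchGrad l S x‖)} :=
    measurableSet_le (hgm.sub_const g).norm (measurable_const.max (hgm.norm.const_mul b))
  -- On the failure event the error exceeds `εg`. It also exceeds `b` times the norm of the
  -- estimate, hence, by the triangle inequality and `b ≤ τ`, it is at least `b ‖g‖ / (1 + τ)`. So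
  -- its square is at least the mean `c` of the two squares, and the two parts of `c` absorb `Mc`
  -- and `Mv ‖g‖²` in Markov's inequality.
  set c := (εg ^ 2 + (b * ‖g‖ / (1 + τ)) ^ 2) / 2 with hc
  have hc0 : 0 < c := by positivity
  have hsub : {S : Fin N → 𝒟 | ‖batchGrad l S x - g‖ ≤ max εg (b * ‖batchGrad l S x‖)}ᶜ
      ⊆ {S | c ≤ ‖batchGrad l S x - g‖ ^ 2} := by
    intro S hS
    simp only [Set.mem_compl_iff, Set.mem_ofPred_eq, not_le, max_lt_iff] at hS ⊢
    obtain ⟨hS1, hS2⟩ := hS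
    have h1 : ‖g‖ ≤ ‖batchGrad l S x‖ + ‖batchGrad l S x - g‖ := by
      have := norm_sub_le (batchGrad l S x) (batchGrad l S x - g)
      rwa [sub_sub_cancel] at this
    have h2 : b * ‖g‖ / (1 + τ) ≤ ‖batchGrad l S x - g‖ := by
      rw [div_le_iff₀ (by positivity)]
      nlinarith [norm_nonneg (batchGrad l S x - g), mul_le_mul_of_nonneg_left h1 hb0.le]
    have h3 := pow_le_pow_left₀ hε.le hS1.le 2
    have h4 := pow_le_pow_left₀ (by positivity) h2 2
    rw [hc]; linarith
  have hmk := mul_meas_ge_le_integral_of_nonneg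
    (Filter.Eventually.of_forall fun S => sq_nonneg ‖batchGrad l S x - g‖) hint c
  have hkey : (Mc + Mv * ‖g‖ ^ 2) / N ≤ c * δ := by
    rw [div_le_iff₀ hN0]
    have h1 : Mc / εg ^ 2 ≤ δ * N / 2 := by
      have : 0 ≤ (1 + τ) ^ 2 * (Mv / b ^ 2) := by positivity
      linarith
    have h2 : (1 + τ) ^ 2 * (Mv / b ^ 2) ≤ δ * N / 2 := by
      have : 0 ≤ Mc / εg ^ 2 := by positivity
      linarith
    calc Mc + Mv * ‖g‖ ^ 2 = Mc / εg ^ 2 * εg ^ 2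
          + (1 + τ) ^ 2 * (Mv / b ^ 2) * (b * ‖g‖ / (1 + τ)) ^ 2 := by field_simp
      _ ≤ δ * N / 2 * εg ^ 2 + δ * N / 2 * (b * ‖g‖ / (1 + τ)) ^ 2 := by gcongr
      _ = _ := by rw [hc]; ring
  have hbad := le_of_mul_le_mul_left (hmk.trans (hle.trans hkey)) hc0
  have hmono := measureReal_mono (μ := Measure.pi fun _ : Fin N => D) hsub (measure_ne_top _ _)
  have hcompl := probReal_compl_eq_one_sub (μ := Measure.pi fun _ : Fin N => D) hmeas
  linarith

theorem SS1.of_le_size {m : ℕ} {𝒟 : Type*} [MeasurableSpace 𝒟] {D : Measure 𝒟}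
    [IsProbabilityMeasure D] {l : EuclideanSpace ℝ (Fin m) → 𝒟 → ℝ} {L : ℝ≥0} {σf Mc Mv : ℝ}
    (hA : ERMAssumptions D l L σf Mc Mv) (hMc : 0 ≤ Mc) (hMv : 0 ≤ Mv) {N₁ : ℝ → ℕ}
    {εg τ κ δ : ℝ} (hε : 0 < εg) (hτ : 0 < τ) (hκ : 0 < κ) (hN : ∀ α > 0, 1 ≤ N₁ α)
    (hsize : ∀ α > 0,
      2 * (Mc / εg ^ 2 + (1 + τ) ^ 2 * (Mv / min τ (κ * α) ^ 2)) ≤ δ * N₁ α) :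
    SS1 D l N₁ εg τ κ δ := fun x α hα =>
  hA.le_measureReal_batchGrad hMc hMv hε (lt_min hτ (mul_pos hκ hα)) (min_le_left _ _)
    (hN α hα) (hsize α hα) x

/-! ### Independence of past and fresh samples -/

/-- If each section of an event about an independent pair `(Y, ξ)` has probability at most `δ`,
then the event carries at most the fraction `δ` of the mass of any nonnegative function of `Y`. -/
theorem setIntegral_le_of_indepFun {Ω S Ξ : Type*} [MeasurableSpace Ω] [MeasurableSpace S]
    [MeasurableSpace Ξ] {P : Measure Ω} [IsProbabilityMeasure P] {Y : Ω → S} {ξ : Ω → Ξ}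
    (hY : Measurable Y) (hξ : Measurable ξ) (hind : IndepFun Y ξ P) {E : Set (S × Ξ)}
    (hE : MeasurableSet E) {δ : ℝ} (hδ : ∀ y, (P.map ξ).real {z | (y, z) ∈ E} ≤ δ)
    {w : S → ℝ} (hw : Measurable w) (hw0 : ∀ y, 0 ≤ w y) (hint : Integrable (fun ω => w (Y ω)) P) :
    ∫ ω in {ω | (Y ω, ξ ω) ∈ E}, w (Y ω) ∂P ≤ δ * ∫ ω, w (Y ω) ∂P := by
  have := Measure.isProbabilityMeasure_map (μ := P) hY.aemeasurable
  have := Measure.isProbabilityMeasure_map (μ := P) hξ.aemeasurable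
  have hint' : Integrable w (P.map Y) :=
    (integrable_map_measure hw.aestronglyMeasurable hY.aemeasurable).2 hint
  -- By independence the joint law is a product, so Fubini integrates out `ξ` first and leaves `w y`
  -- times the probability of the section.
  set F : S × Ξ → ℝ := E.indicator fun p => w p.1 with hF
  have hFm : Measurable F := (hw.comp measurable_fst).indicator hE
  have hFint : Integrable F ((P.map Y).prod (P.map ξ)) := (hint'.comp_fst _).indicator hE
  have h1 : ∫ ω in {ω | (Y ω, ξ ω) ∈ E}, w (Y ω) ∂P
      = ∫ p, F p ∂((P.map Y).prod (P.map ξ)) := by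
    rw [← (indepFun_iff_map_prod_eq_prod_map_map hY.aemeasurable hξ.aemeasurable).1 hind,
      integral_map (hY.prodMk hξ).aemeasurable hFm.aestronglyMeasurable,
      ← integral_indicator (s := {ω | (Y ω, ξ ω) ∈ E}) (hY.prodMk hξ hE)]
    rfl
  have h2 : ∀ y, ∫ z, F (y, z) ∂(P.map ξ) = (P.map ξ).real {z | (y, z) ∈ E} * w y := by
    intro y
    have h3 : (fun z => F (y, z)) = {z | (y, z) ∈ E}.indicator fun _ => w y := rfl
    rw [h3, integral_indicator_const (s := {z | (y, z) ∈ E}) _ (measurable_prodMk_left hE),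
      smul_eq_mul]
  rw [h1, integral_prod F hFint, ← integral_map hY.aemeasurable hw.aestronglyMeasurable,
    ← integral_const_mul]
  refine integral_mono hFint.integral_prod_left (hint'.const_mul δ) fun y => ?_
  rw [h2 y]
  exact mul_le_mul_of_nonneg_right (hδ y) (hw0 y)

/-- The `σ`-algebra generated by the samples with indices in `I`. -/
abbrev samplesIn {𝒟 Ω : Type*} [MeasurableSpace 𝒟] (d : ℕ → Fin 3 → ℕ → Ω → 𝒟)
    (I : Set (ℕ × Fin 3 × ℕ)) : MeasurableSpace Ω :=
  ⨆ a ∈ I, MeasurableSpace.comap (d a.1 a.2.1 a.2.2) inferInstance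

theorem measurable_samplesIn {𝒟 Ω : Type*} [MeasurableSpace 𝒟] (d : ℕ → Fin 3 → ℕ → Ω → 𝒟)
    {I : Set (ℕ × Fin 3 × ℕ)} {k : ℕ} {j : Fin 3} (h : ∀ i, (k, j, i) ∈ I) :
    Measurable[samplesIn d I] (fun ω i => d k j i ω) := by
  refine @measurable_pi_lambda _ _ _ (samplesIn d I) _ _ fun i => ?_
  exact (comap_measurable (d k j i)).mono
    (le_iSup₂_of_le (f := fun (a : ℕ × Fin 3 × ℕ) (_ : a ∈ I) =>
      MeasurableSpace.comap (d a.1 a.2.1 a.2.2) inferInstance) (k, j, i) (h i) le_rfl) le_rfl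

theorem samplesIn_mono {𝒟 Ω : Type*} [MeasurableSpace 𝒟] (d : ℕ → Fin 3 → ℕ → Ω → 𝒟)
    {I J : Set (ℕ × Fin 3 × ℕ)} (h : I ⊆ J) : samplesIn d I ≤ samplesIn d J :=
  biSup_mono fun _ ha => h ha

theorem pastSamples_le_samplesIn {𝒟 Ω : Type*} [MeasurableSpace 𝒟] (d : ℕ → Fin 3 → ℕ → Ω → 𝒟)
    (k : ℕ) : pastSamples d k ≤ samplesIn d {a | a.1 < k} :=
  iSup₂_le fun i hi => iSup₂_le fun j t =>
    le_iSup₂_of_le (f := fun (a : ℕ × Fin 3 × ℕ) (_ : a ∈ {a : ℕ × Fin 3 × ℕ | a.1 < k}) =>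
      MeasurableSpace.comap (d a.1 a.2.1 a.2.2) inferInstance) (i, j, t) hi le_rfl

namespace SASSRandomness

variable {m : ℕ} {𝒟 Ω : Type*} [MeasurableSpace 𝒟] [MeasurableSpace Ω] {D : Measure 𝒟}
  {P : Measure Ω} {h₁ h₂ : ℝ} {d : ℕ → Fin 3 → ℕ → Ω → 𝒟}
  {H : ℕ → Ω → Matrix (Fin m) (Fin m) ℝ}

theorem samplesIn_le (hR : SASSRandomness D P h₁ h₂ d H) (I : Set (ℕ × Fin 3 × ℕ)) :
    samplesIn d I ≤ (inferInstance : MeasurableSpace Ω) :=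
  iSup₂_le fun _ _ => (hR.measurable_sample _ _ _).comap_le

theorem indepFun_of_disjoint (hR : SASSRandomness D P h₁ h₂ d H) {I J : Set (ℕ × Fin 3 × ℕ)}
    (hIJ : Disjoint I J) {S Ξ : Type*} [MeasurableSpace S] [MeasurableSpace Ξ] {Y : Ω → S}
    {ξ : Ω → Ξ} (hY : Measurable[samplesIn d I] Y) (hξ : Measurable[samplesIn d J] ξ) :
    IndepFun Y ξ P := by
  have h := indep_iSup_of_disjoint
    (fun a : ℕ × Fin 3 × ℕ => (hR.measurable_sample a.1 a.2.1 a.2.2).comap_le)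
    hR.indep_sample hIJ
  exact indep_of_indep_of_le_left (indep_of_indep_of_le_right h hξ.comap_le) hY.comap_le

/-- A minibatch of size `N` from one stream has law `D ^ N`. -/
theorem map_real_eq_pi [IsProbabilityMeasure P] [IsProbabilityMeasure D]
    (hR : SASSRandomness D P h₁ h₂ d H) (k : ℕ) (j : Fin 3)
    (N : ℕ) {B : Set (Fin N → 𝒟)} (hB : MeasurableSet B) :
    (P.map fun ω i => d k j i ω).real {z | (fun i : Fin N => z i) ∈ B}
      = (Measure.pi fun _ : Fin N => D).real B := by
  have hinj : Function.Injective (fun i : Fin N => (k, j, (i : ℕ))) := by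
    intro a b hab
    simpa [Fin.ext_iff] using hab
  have h0 : iIndepFun (fun i : Fin N => d k j i) P := hR.indep_sample.precomp hinj
  have hae : ∀ i : Fin N, AEMeasurable (d k j i) P :=
    fun i => (hR.measurable_sample k j i).aemeasurable
  have h1 : P.map (fun ω (i : Fin N) => d k j i ω) = Measure.pi fun i : Fin N => P.map (d k j i) :=
    h0.map_fun_eq_pi_map hae
  simp only [hR.law_sample] at h1
  rw [← h1]
  have hm : Measurable (fun z : ℕ → 𝒟 => fun i : Fin N => z i) := by fun_prop
  have hmB : MeasurableSet {z : ℕ → 𝒟 | (fun i : Fin N => z i) ∈ B} := hm hB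
  rw [map_measureReal_apply (measurable_pi_lambda _ fun i => hR.measurable_sample k j i) hmB,
    map_measureReal_apply
      (measurable_pi_lambda _ fun i : Fin N => hR.measurable_sample k j i) hB]
  rfl

end SASSRandomness

/-! ### Measurability of one iteration -/

/-- The gradient estimate of an iteration from `(x, α)` with gradient samples `z`. -/
noncomputable def sassGrad {m : ℕ} {𝒟 : Type*} (l : EuclideanSpace ℝ (Fin m) → 𝒟 → ℝ) (N₁ : ℝ → ℕ)
    (z : ℕ → 𝒟) (x : EuclideanSpace ℝ (Fin m)) (α : ℝ) : EuclideanSpace ℝ (Fin m) :=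
  batchGrad l (fun i : Fin (N₁ α) => z i) x

/-- The trial step of an iteration from `(x, α)` with gradient samples `z`. -/
noncomputable def sassTrial {m : ℕ} {𝒟 : Type*} (l : EuclideanSpace ℝ (Fin m) → 𝒟 → ℝ) (N₁ : ℝ → ℕ)
    (H : Matrix (Fin m) (Fin m) ℝ) (z : ℕ → 𝒟) (x : EuclideanSpace ℝ (Fin m)) (α : ℝ) :
    EuclideanSpace ℝ (Fin m) :=
  -(α • Matrix.toEuclideanLin H⁻¹ (sassGrad l N₁ z x α))

section Measurability

variable {m : ℕ} {𝒟 Ω : Type*} [MeasurableSpace 𝒟] {mΩ : MeasurableSpace Ω}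
  {l : EuclideanSpace ℝ (Fin m) → 𝒟 → ℝ} {N₁ : ℝ → ℕ} {H : Ω → Matrix (Fin m) (Fin m) ℝ}
  {x : Ω → EuclideanSpace ℝ (Fin m)} {α : Ω → ℝ}

theorem measurable_sassGrad (hl : Measurable (Function.uncurry l))
    (hd : ∀ d, Differentiable ℝ (fun x => l x d)) (hN : Measurable N₁) {z : Ω → ℕ → 𝒟}
    (hx : Measurable x) (hα : Measurable α) (hz : Measurable z) :
    Measurable (fun ω => sassGrad l N₁ (z ω) (x ω) (α ω)) := by
  have := (measurable_batchGrad_size hl hd hN).comp ((hx.prodMk hα).prodMk hz)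
  simpa only [Function.comp_def, sassGrad] using this

theorem measurable_sassTrial (hl : Measurable (Function.uncurry l))
    (hd : ∀ d, Differentiable ℝ (fun x => l x d)) (hN : Measurable N₁) {z : Ω → ℕ → 𝒟}
    (hH : ∀ a b, Measurable (fun ω => H ω a b))
    (hx : Measurable x) (hα : Measurable α) (hz : Measurable z) :
    Measurable (fun ω => sassTrial l N₁ (H ω) (z ω) (x ω) (α ω)) :=
  (hα.smul (measurable_toEuclideanLin_apply (fun a b => measurable_matrix_inv_apply hH a b)
    (measurable_sassGrad hl hd hN hx hα hz))).neg

theorem measurable_batchValue_comp (hl : Measurable (Function.uncurry l)) {z : Ω → ℕ → 𝒟}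
    (hx : Measurable x) (hz : Measurable z) (N : ℕ) :
    Measurable (fun ω => batchValue l (fun i : Fin N => z ω i) (x ω)) := by
  have hp : Measurable (fun ω => (x ω, fun i : Fin N => z ω i)) :=
    hx.prodMk (measurable_pi_lambda _ fun i => (measurable_pi_apply _).comp hz)
  have := (measurable_batchValue hl N).comp hp
  simpa only [Function.comp_def] using this

theorem measurable_sassStep (hl : Measurable (Function.uncurry l))
    (hd : ∀ d, Differentiable ℝ (fun x => l x d)) (hN : Measurable N₁) {z : Ω → Fin 3 → ℕ → 𝒟}
    (hH : ∀ a b, Measurable (fun ω => H ω a b)) {θ γ r : ℝ} {αmax : ℝ≥0∞} {N₀ : ℕ}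
    {s : Ω → EuclideanSpace ℝ (Fin m) × ℝ} (hs : Measurable s)
    (hz : ∀ j, Measurable (fun ω => z ω j)) :
    Measurable (fun ω => sassStep l θ γ r αmax N₀ N₁ (H ω) (z ω) (s ω)) := by
  have hg := measurable_sassGrad hl hd hN hs.fst hs.snd (hz 2)
  have ht := measurable_sassTrial hl hd hN hH hs.fst hs.snd (hz 2)
  have hf0 := measurable_batchValue_comp hl hs.fst (hz 0) N₀
  have hf1 := measurable_batchValue_comp hl (hs.fst.add ht) (hz 1) N₀
  refine Measurable.ite (measurableSet_le
    (((hg.inner ht).const_mul (-θ)).sub_const r) (hf0.sub hf1)) ?_ ?_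
  · exact (hs.fst.add ht).prodMk
      (((hs.snd.const_mul _).ennreal_ofReal.min measurable_const).ennreal_toReal)
  · exact hs.fst.prodMk (hs.snd.const_mul γ)

end Measurability

/-! ### The step size penalty and its change in one iteration -/

/-- The penalty `max {(β / α)², 1}` for step size parameters `α` below the threshold `β`. -/
noncomputable def stepPenalty (β α : ℝ) : ℝ := max ((β / α) ^ 2) 1

theorem one_le_stepPenalty (β α : ℝ) : 1 ≤ stepPenalty β α := le_max_right _ _

theorem stepPenalty_eq_one {β α : ℝ} (hβ : 0 < β) (h : β ≤ α) : stepPenalty β α = 1 := by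
  refine max_eq_right (pow_le_one₀ (div_nonneg hβ.le (hβ.le.trans h)) ?_)
  exact (div_le_one (hβ.trans_le h)).2 h

/-- This describes an accepted step. The new step size may be cut off by `αmax`, but not below `β`,
so only the lower bound by `min (γ⁻¹ * α) β` is available and needed. -/
theorem stepPenalty_of_le {β α α' γ : ℝ} (hβ : 0 < β) (hα : 0 < α) (hγ : 0 < γ)
    (h : min (γ⁻¹ * α) β ≤ α') : stepPenalty β α' ≤ max (γ ^ 2 * stepPenalty β α) 1 := by
  have hm : 0 < min (γ⁻¹ * α) β := lt_min (by positivity) hβ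
  have hq : 0 ≤ β / α' := div_nonneg hβ.le (hm.le.trans h)
  refine max_le ?_ (le_max_right _ _)
  have h1 : (β / α') ^ 2 ≤ (β / min (γ⁻¹ * α) β) ^ 2 := by gcongr
  refine h1.trans ?_
  rcases min_choice (γ⁻¹ * α) β with h2 | h2 <;> rw [h2]
  · refine le_max_of_le_left ?_
    calc (β / (γ⁻¹ * α)) ^ 2 = γ ^ 2 * (β / α) ^ 2 := by field_simp
      _ ≤ _ := by gcongr; exact le_max_left _ _
  · rw [div_self hβ.ne', one_pow]
    exact le_max_right _ _

theorem stepPenalty_mul_le {β α γ : ℝ} (hγ : 0 < γ) (hγ' : γ < 1) :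
    stepPenalty β (γ * α) ≤ stepPenalty β α / γ ^ 2 := by
  have h2 : 0 < γ ^ 2 := by positivity
  rw [le_div_iff₀ h2]
  have h1 : γ ^ 2 ≤ 1 := pow_le_one₀ hγ.le hγ'.le
  unfold stepPenalty
  rw [max_mul_of_nonneg _ _ h2.le]
  refine max_le_max (le_of_eq ?_) (by linarith)
  rw [← mul_pow]
  congr 1
  field_simp

/-- The minimum is finite even for `αmax = ⊤`, so `toReal` does not take its default value `0`. -/
theorem le_toReal_min_ofReal {a b α₀ : ℝ} {αmax : ℝ≥0∞} (hb : b ≤ α₀)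
    (hα₀ : ENNReal.ofReal α₀ ≤ αmax) : min a b ≤ (min (ENNReal.ofReal a) αmax).toReal := by
  rw [← ENNReal.ofReal_le_iff_le_toReal (ne_top_of_le_ne_top ENNReal.ofReal_ne_top
    (min_le_left _ _))]
  exact le_min (ENNReal.ofReal_le_ofReal (min_le_left _ _))
    ((ENNReal.ofReal_le_ofReal ((min_le_right _ _).trans hb)).trans hα₀)

/-- From an accurate gradient estimate at a point with large gradient to a relative error bound. -/
theorem norm_sub_le_mul_norm_of_accurate {E : Type*} [NormedAddCommGroup E] {g G : E}
    {η ε τ κ α : ℝ} (hη : 0 < η) (hη' : η < 1) (hε : ε < ‖G‖)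
    (h : ‖g - G‖ ≤ max (η * ε) (min τ (κ * α) * ‖g‖)) :
    ‖g - G‖ ≤ max (η / (1 - η)) (κ * α) * ‖g‖ := by
  rcases le_max_iff.1 h with h1 | h1
  · have h2 : ‖G‖ ≤ ‖g‖ + ‖g - G‖ := by
      have := norm_sub_le g (g - G)
      rwa [sub_sub_cancel] at this
    have h3 : ‖g - G‖ ≤ η / (1 - η) * ‖g‖ := by
      rw [div_mul_eq_mul_div, le_div_iff₀ (by linarith)]
      nlinarith
    exact h3.trans (by gcongr; exact le_max_left _ _)
  · exact h1.trans (by gcongr; exact (min_le_right _ _).trans (le_max_right _ _))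

/-- At `β = 0` the left side reduces to that of `hηθ`, where the inequality is strict; by continuity
it survives for small `β > 0`. -/
theorem exists_step_threshold {θ α₀ h₁ h₂ κ η L : ℝ} (hα₀ : 0 < α₀)
    (hη : 0 < η) (hη' : η < 1) (hηθ : η / (1 - η) * √(h₂ / h₁) < 1 - θ) :
    ∃ β > 0, β ≤ α₀ ∧ max (η / (1 - η)) (κ * β) * √(h₂ / h₁) + L * β / (2 * h₁) ≤ 1 - θ := by
  have hc : Continuous fun β : ℝ =>
      max (η / (1 - η)) (κ * β) * √(h₂ / h₁) + L * β / (2 * h₁) := by fun_prop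
  have h0 : max (η / (1 - η)) (κ * 0) * √(h₂ / h₁) + L * 0 / (2 * h₁) < 1 - θ := by
    rw [mul_zero, max_eq_left (div_nonneg hη.le (by linarith))]
    simpa using hηθ
  have h1 := (hc.tendsto 0).eventually (Iio_mem_nhds h0)
  have h2 := (h1.filter_mono (nhdsWithin_le_nhds (s := Set.Ioi 0))).and (Ioc_mem_nhdsGT hα₀)
  obtain ⟨β, hβ, hβ'⟩ := h2.exists
  exact ⟨β, hβ'.1, hβ'.2, le_of_lt hβ⟩

/-- One iteration of SASS: the step size parameter stays positive, its penalty grows by at most the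
factor `γ⁻²`, and it contracts, up to an offset, if the estimates are accurate and the gradient is
large. -/
theorem stepPenalty_sassStep_le {m : ℕ} {𝒟 : Type*}
    {l : EuclideanSpace ℝ (Fin m) → 𝒟 → ℝ} {φ : EuclideanSpace ℝ (Fin m) → ℝ} {L : ℝ≥0}
    (hφ : Differentiable ℝ φ) (hL : LipschitzWith L (∇ φ)) {θ h₁ h₂ κ η α₀ β γ r : ℝ}
    (hh₁ : 0 < h₁) (hh₂ : 0 < h₂) (hκ : 0 < κ) (hη : 0 < η) (hη' : η < 1)
    (hβ : 0 < β) (hβα : β ≤ α₀)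
    (hβθ : max (η / (1 - η)) (κ * β) * √(h₂ / h₁) + L * β / (2 * h₁) ≤ 1 - θ)
    (hγ : 0 < γ) (hγ' : γ < 1) {αmax : ℝ≥0∞} (hmax : ENNReal.ofReal α₀ ≤ αmax)
    {H : Matrix (Fin m) (Fin m) ℝ} (hH : H.PosDef)
    (lower : ∀ v : EuclideanSpace ℝ (Fin m), h₁ * ‖v‖ ^ 2 ≤ ⟪v, Matrix.toEuclideanLin H v⟫)
    (upper : ∀ v : EuclideanSpace ℝ (Fin m), ⟪v, Matrix.toEuclideanLin H v⟫ ≤ h₂ * ‖v‖ ^ 2)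
    (N₀ : ℕ) (N₁ : ℝ → ℕ) (z : Fin 3 → ℕ → 𝒟) (x : EuclideanSpace ℝ (Fin m)) {α : ℝ}
    (hα : 0 < α) {α' : ℝ} (hα' : α' = (sassStep l θ γ r αmax N₀ N₁ H z (x, α)).2) :
    0 < α' ∧ stepPenalty β α' ≤ stepPenalty β α / γ ^ 2 ∧
    ∀ ε τ, ε < ‖∇ φ x‖ →
      |φ x - batchValue l (fun i : Fin N₀ => z 0 i) x| < r / 2 →
      |φ (x + sassTrial l N₁ H (z 2) x α) -
        batchValue l (fun i : Fin N₀ => z 1 i) (x + sassTrial l N₁ H (z 2) x α)| < r / 2 →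
      ‖sassGrad l N₁ (z 2) x α - ∇ φ x‖
        ≤ max (η * ε) (min τ (κ * α) * ‖sassGrad l N₁ (z 2) x α‖) →
      stepPenalty β α' ≤ γ ^ 2 * stepPenalty β α + (1 / γ ^ 2 - γ ^ 2) := by
  set t := sassTrial l N₁ H (z 2) x α with ht
  set g := sassGrad l N₁ (z 2) x α with hg
  have hs : α' = if batchValue l (fun i : Fin N₀ => z 0 i) x
      - batchValue l (fun i : Fin N₀ => z 1 i) (x + t) ≥ -θ * ⟪g, t⟫ - r
      then (min (ENNReal.ofReal (γ⁻¹ * α)) αmax).toReal else γ * α := by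
    rw [hα']
    exact apply_ite Prod.snd _ _ _
  have hγ2 : 0 < γ ^ 2 := by positivity
  have hγ1 : γ ^ 2 < 1 := pow_lt_one₀ hγ.le hγ' two_ne_zero
  have hinv : 1 < 1 / γ ^ 2 := (one_lt_div hγ2).2 hγ1
  have hW := one_le_stepPenalty β α
  have hacc : min (γ⁻¹ * α) β ≤ (min (ENNReal.ofReal (γ⁻¹ * α)) αmax).toReal :=
    le_toReal_min_ofReal hβα hmax
  have hmin : 0 < min (γ⁻¹ * α) β := lt_min (by positivity) hβ
  have hgrow : stepPenalty β α ≤ stepPenalty β α / γ ^ 2 :=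
    le_div_self (by linarith) hγ2 hγ1.le
  have hsucc := stepPenalty_of_le hβ hα hγ hacc
  have hsucc' : max (γ ^ 2 * stepPenalty β α) 1 ≤ stepPenalty β α :=
    max_le (mul_le_of_le_one_left (by linarith) hγ1.le) hW
  refine ⟨?_, ?_, ?_⟩
  · rw [hs]
    split_ifs
    · exact hmin.trans_le hacc
    · positivity
  · rw [hs]
    split_ifs
    · linarith
    · exact stepPenalty_mul_le hγ hγ'
  · intro ε τ hε hf0 hf1 hgr
    -- For `α ≥ β` the step may fail despite accurate estimates, but then the penalty is `1` and
    -- grows to at most `1 / γ²`. The offset `1 / γ² - γ²` is exactly what covers this case.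
    rcases le_or_gt β α with hβ' | hβ'
    · have hbound : stepPenalty β α' ≤ stepPenalty β α / γ ^ 2 := by
        rw [hs]
        split_ifs
        · linarith
        · exact stepPenalty_mul_le hγ hγ'
      rw [stepPenalty_eq_one hβ hβ'] at hbound ⊢
      linarith
    · have hrel := norm_sub_le_mul_norm_of_accurate hη hη' hε hgr
      have hθα : max (η / (1 - η)) (κ * α) * √(h₂ / h₁) + L * α / (2 * h₁) ≤ 1 - θ := by
        refine le_trans ?_ hβθ
        gcongr
      obtain ⟨hb1, hb2⟩ := hH.inv_bounds hh₂ lower upper g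
      have hdec := sufficient_decrease hφ hL hh₁ hh₂ hα.le
        (le_max_of_le_right (by positivity)) hθα hrel hb1 hb2
      have hdec' : φ (x + t) ≤ φ x + θ * ⟪g, t⟫ := hdec
      -- The two function value errors are below `r / 2` each, so the slack `r` in the acceptance
      -- test compensates them and the step is accepted.
      have h0 := (abs_lt.1 hf0).2
      have h1 := (abs_lt.1 hf1).1
      rw [if_pos (by linarith)] at hs
      rw [hs]
      refine hsucc.trans (max_le (by linarith) ?_)
      nlinarith

/-! ### From a drift condition to a uniform bound -/

/-- A drift condition for nonnegative random variables, in which the exceptional events carry at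
most the fractions `δ j` of the mass, bounds all the expectations. -/
theorem integral_le_of_drift {Ω : Type*} [MeasurableSpace Ω] {P : Measure Ω}
    [IsProbabilityMeasure P] {w : ℕ → Ω → ℝ} {B : ℕ → Fin 3 → Set Ω} {δ : Fin 3 → ℝ} {s b M : ℝ}
    (hs : 0 ≤ s) (hb : 0 ≤ b) (hint : ∀ k, Integrable (w k) P)
    (hB : ∀ k j, MeasurableSet (B k j)) (h0 : ∫ ω, w 0 ω ∂P ≤ M)
    (hstep : ∀ k ω, w (k + 1) ω ≤ s * w k ω + b + b * ∑ j, (B k j).indicator (w k) ω)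
    (hbad : ∀ k j, ∫ ω in B k j, w k ω ∂P ≤ δ j * ∫ ω, w k ω ∂P)
    (hδ : 0 ≤ ∑ j, δ j) (hM : s * M + b + b * ((∑ j, δ j) * M) ≤ M) (k : ℕ) :
    ∫ ω, w k ω ∂P ≤ M := by
  induction k with
  | zero => exact h0
  | succ k ih =>
    have hi : ∀ j, Integrable ((B k j).indicator (w k)) P := fun j => (hint k).indicator (hB k j)
    have hsum : Integrable (fun ω => ∑ j, (B k j).indicator (w k) ω) P :=
      integrable_finsetSum _ fun j _ => hi j
    have hlin : Integrable (fun ω => s * w k ω + b) P :=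
      ((hint k).const_mul s).add (integrable_const b)
    calc ∫ ω, w (k + 1) ω ∂P
        ≤ ∫ ω, (s * w k ω + b + b * ∑ j, (B k j).indicator (w k) ω) ∂P :=
          integral_mono (hint _) (hlin.add (hsum.const_mul b)) (hstep k)
      _ = s * ∫ ω, w k ω ∂P + b + b * ∑ j, ∫ ω in B k j, w k ω ∂P := by
          rw [integral_add hlin (hsum.const_mul b), integral_add ((hint k).const_mul s)
            (integrable_const b), integral_const_mul, integral_const_mul,
            integral_finsetSum _ fun j _ => hi j]
          simp only [integral_const, probReal_univ, one_smul, integral_indicator (hB k _)]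
      _ ≤ s * ∫ ω, w k ω ∂P + b + b * ∑ j, δ j * ∫ ω, w k ω ∂P := by
          gcongr with j _
          exact hbad k j
      _ ≤ s * M + b + b * ((∑ j, δ j) * M) := by
          rw [← Finset.sum_mul]
          gcongr
      _ ≤ M := hM

/-- With `s = γ²`, a bound `M` is preserved by the recursion exactly when `M (p s - q) ≥ 1 + s`,
after cancelling `(1 - s) / s`. Since `s > 2 q` gives `p s - q ≥ q (2 p - 1)`, and `1 + s ≤ 2`, one
`M` works for all admissible `γ`. -/
theorem drift_bound {p q s : ℝ} (hq : 0 < q) (hp : 1 / 2 < p) (hpq : q = 1 - p)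
    (hs : 2 * q < s) (hs' : s < 1) :
    s * (2 / (q * (2 * p - 1))) + (1 / s - s) + (1 / s - s) * (q * (2 / (q * (2 * p - 1))))
      ≤ 2 / (q * (2 * p - 1)) := by
  have h1 : 0 < 2 * p - 1 := by linarith
  have hs0 : 0 < s := by linarith
  set M := 2 / (q * (2 * p - 1)) with hM
  have hM0 : 0 < M := by positivity
  have h2 : 2 ≤ M * (p * s - q) := by
    have h3 : q * (2 * p - 1) ≤ p * s - q := by nlinarith
    calc 2 = M * (q * (2 * p - 1)) := by rw [hM]; field_simp
      _ ≤ _ := by gcongr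
  have h4 : M - (s * M + (1 / s - s) + (1 / s - s) * (q * M))
      = (1 - s) / s * (M * (p * s - q) - (1 + s)) := by
    rw [hpq]; field_simp; ring
  have h5 : 0 ≤ (1 - s) / s * (M * (p * s - q) - (1 + s)) :=
    mul_nonneg (div_nonneg (by linarith) hs0.le) (by linarith)
  linarith

/-! ### Adaptedness of the states and the mass of the inaccuracy events -/

namespace SASSRandomness

variable {m : ℕ} {𝒟 Ω : Type*} [MeasurableSpace 𝒟] [MeasurableSpace Ω] {D : Measure 𝒟}
  {P : Measure Ω} {h₁ h₂ : ℝ}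
  {d : ℕ → Fin 3 → ℕ → Ω → 𝒟} {H : ℕ → Ω → Matrix (Fin m) (Fin m) ℝ}
  {l : EuclideanSpace ℝ (Fin m) → 𝒟 → ℝ} {L : ℝ≥0} {σf Mc Mv : ℝ}

/-- The states of SASS depend measurably on the samples of the earlier iterations. -/
theorem measurable_sassPath (hR : SASSRandomness D P h₁ h₂ d H)
    (hA : ERMAssumptions D l L σf Mc Mv) {N₁ : ℝ → ℕ} (hN : Measurable N₁) (θ γ r : ℝ)
    (αmax : ℝ≥0∞) (N₀ : ℕ) (x₀ : EuclideanSpace ℝ (Fin m)) (α₀ : ℝ) (k : ℕ) :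
    Measurable[samplesIn d {a | a.1 < k}] fun ω => sassPath l θ γ r αmax N₀ N₁ x₀ α₀
      (fun i => H i ω) (fun i j t => d i j t ω) k := by
  induction k with
  | zero => exact measurable_const
  | succ k ih =>
    have hle : samplesIn d {a | a.1 < k} ≤ samplesIn d {a | a.1 < k + 1} :=
      samplesIn_mono d fun a (ha : a.1 < k) => Nat.lt_succ_of_lt ha
    exact measurable_sassStep (mΩ := samplesIn d {a | a.1 < k + 1}) hA.measurable_loss
      hA.differentiable_loss hN
      (fun a b => (hR.adapted k a b).mono ((pastSamples_le_samplesIn d k).trans hle) le_rfl)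
      (ih.mono hle le_rfl) (fun j => measurable_samplesIn d fun i => Nat.lt_succ_self k)

variable [IsProbabilityMeasure P] [IsProbabilityMeasure D]

/-- A function value estimate from fresh samples is inaccurate on a set that carries at most the
fraction `δfun t` of the mass of any nonnegative function of the other samples. -/
theorem setIntegral_value_le (hR : SASSRandomness D P h₁ h₂ d H)
    (hA : ERMAssumptions D l L σf Mc Mv) {N₀ : ℕ} {εf : ℝ} {δfun : ℝ → ℝ}
    (h0 : SS0 D l N₀ εf δfun) {t : ℝ} (ht : 0 < t) {I : Set (ℕ × Fin 3 × ℕ)} {k : ℕ} {j : Fin 3}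
    (hI : ∀ i, (k, j, i) ∉ I) {y : Ω → EuclideanSpace ℝ (Fin m)}
    (hy : Measurable[samplesIn d I] y) {w : Ω → ℝ} (hw : Measurable[samplesIn d I] w)
    (hw0 : ∀ ω, 0 ≤ w ω) (hint : Integrable w P) :
    MeasurableSet {ω | ¬ |risk D l (y ω) - batchValue l (fun i : Fin N₀ => d k j i ω) (y ω)|
        < εf + t} ∧
    ∫ ω in {ω | ¬ |risk D l (y ω) - batchValue l (fun i : Fin N₀ => d k j i ω) (y ω)| < εf + t},
      w ω ∂P ≤ δfun t * ∫ ω, w ω ∂P := by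
  have hφ : Continuous (risk D l) := hA.differentiable_risk.continuous
  set E : Set ((EuclideanSpace ℝ (Fin m) × ℝ) × (ℕ → 𝒟)) :=
    {p | ¬ |risk D l p.1.1 - batchValue l (fun i : Fin N₀ => p.2 i) p.1.1| < εf + t} with hE
  have hbv : Measurable fun p : (EuclideanSpace ℝ (Fin m) × ℝ) × (ℕ → 𝒟) =>
      batchValue l (fun i : Fin N₀ => p.2 i) p.1.1 :=
    measurable_batchValue_comp hA.measurable_loss measurable_fst.fst measurable_snd N₀
  have hEm : MeasurableSet E := (measurableSet_lt
    ((hφ.measurable.comp measurable_fst.fst).sub hbv).abs measurable_const).compl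
  -- The weight is carried along as a component of the independent variable; its absolute value is
  -- used below because the weight function must be nonnegative on the whole product.
  have hY : Measurable[samplesIn d I] fun ω => (y ω, w ω) := hy.prodMk hw
  have hξ : Measurable[samplesIn d {a | a.1 = k ∧ a.2.1 = j}] fun ω i => d k j i ω :=
    measurable_samplesIn d fun i => ⟨rfl, rfl⟩
  have hdisj : Disjoint I {a : ℕ × Fin 3 × ℕ | a.1 = k ∧ a.2.1 = j} := by
    rw [Set.disjoint_left]
    rintro ⟨a, b, c⟩ ha ⟨rfl, rfl⟩
    exact hI c ha
  have hY' := hY.mono (hR.samplesIn_le I) le_rfl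
  have hξ' := hξ.mono (hR.samplesIn_le _) le_rfl
  have habs : ∀ ω, |w ω| = w ω := fun ω => abs_of_nonneg (hw0 ω)
  have key := setIntegral_le_of_indepFun (δ := δfun t) (w := fun p => |p.2|) hY' hξ'
    (hR.indepFun_of_disjoint hdisj hY hξ) hEm ?_ measurable_snd.abs (fun _ => abs_nonneg _)
    (by simpa only [habs] using hint)
  · simp only [habs] at key
    exact ⟨(hY'.prodMk hξ') hEm, key⟩
  · rintro ⟨x, a⟩
    have hBm : MeasurableSet {S : Fin N₀ → 𝒟 | |risk D l x - batchValue l S x| < εf + t} :=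
      measurableSet_lt (((measurable_batchValue hA.measurable_loss N₀).comp
        (measurable_const.prodMk measurable_id)).const_sub _).abs measurable_const
    have h1 := hR.map_real_eq_pi k j N₀ hBm.compl
    rw [probReal_compl_eq_one_sub hBm] at h1
    have h2 := h0 x t ht
    calc _ = _ := h1
      _ ≤ δfun t := by linarith

/-- The analogue of `setIntegral_value_le` for gradient estimates. -/
theorem setIntegral_grad_le (hR : SASSRandomness D P h₁ h₂ d H)
    (hA : ERMAssumptions D l L σf Mc Mv) {N₁ : ℝ → ℕ} (hN : Measurable N₁) {εg τ κ δ : ℝ}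
    (h1 : SS1 D l N₁ εg τ κ δ) (hδ : 0 ≤ δ) {I : Set (ℕ × Fin 3 × ℕ)} {k : ℕ} {j : Fin 3}
    (hI : ∀ i, (k, j, i) ∉ I) {y : Ω → EuclideanSpace ℝ (Fin m)}
    (hy : Measurable[samplesIn d I] y) {α : Ω → ℝ} (hα : Measurable[samplesIn d I] α)
    (hα0 : ∀ ω, 0 < α ω) {w : Ω → ℝ} (hw : Measurable[samplesIn d I] w)
    (hw0 : ∀ ω, 0 ≤ w ω) (hint : Integrable w P) :
    MeasurableSet {ω | ¬ ‖sassGrad l N₁ (fun i => d k j i ω) (y ω) (α ω) - ∇ (risk D l) (y ω)‖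
      ≤ max εg (min τ (κ * α ω) * ‖sassGrad l N₁ (fun i => d k j i ω) (y ω) (α ω)‖)} ∧
    ∫ ω in {ω | ¬ ‖sassGrad l N₁ (fun i => d k j i ω) (y ω) (α ω) - ∇ (risk D l) (y ω)‖
      ≤ max εg (min τ (κ * α ω) * ‖sassGrad l N₁ (fun i => d k j i ω) (y ω) (α ω)‖)},
      w ω ∂P ≤ δ * ∫ ω, w ω ∂P := by
  have hG : Continuous (∇ (risk D l)) := hA.lipschitz_gradient.continuous
  -- The first-order oracle speaks only about `α > 0`, while every section of the event must be
  -- bounded. Requiring positivity in `E` makes the other sections empty and changes nothing along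
  -- the run.
  set E : Set ((EuclideanSpace ℝ (Fin m) × ℝ × ℝ) × (ℕ → 𝒟)) :=
    {p | 0 < p.1.2.1 ∧ ¬ ‖sassGrad l N₁ p.2 p.1.1 p.1.2.1 - ∇ (risk D l) p.1.1‖
      ≤ max εg (min τ (κ * p.1.2.1) * ‖sassGrad l N₁ p.2 p.1.1 p.1.2.1‖)} with hE
  have hg : Measurable fun p : (EuclideanSpace ℝ (Fin m) × ℝ × ℝ) × (ℕ → 𝒟) =>
      sassGrad l N₁ p.2 p.1.1 p.1.2.1 :=
    measurable_sassGrad hA.measurable_loss hA.differentiable_loss hN measurable_fst.fst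
      measurable_fst.snd.fst measurable_snd
  have hEm : MeasurableSet E := (measurableSet_lt measurable_const measurable_fst.snd.fst).inter
    (measurableSet_le (hg.sub (hG.measurable.comp measurable_fst.fst)).norm
      (measurable_const.max (((measurable_const.min
        (measurable_fst.snd.fst.const_mul κ))).mul hg.norm))).compl
  have hY : Measurable[samplesIn d I] fun ω => (y ω, α ω, w ω) := hy.prodMk (hα.prodMk hw)
  have hξ : Measurable[samplesIn d {a | a.1 = k ∧ a.2.1 = j}] fun ω i => d k j i ω :=
    measurable_samplesIn d fun i => ⟨rfl, rfl⟩
  have hdisj : Disjoint I {a : ℕ × Fin 3 × ℕ | a.1 = k ∧ a.2.1 = j} := by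
    rw [Set.disjoint_left]
    rintro ⟨a, b, c⟩ ha ⟨rfl, rfl⟩
    exact hI c ha
  have hY' := hY.mono (hR.samplesIn_le I) le_rfl
  have hξ' := hξ.mono (hR.samplesIn_le _) le_rfl
  have habs : ∀ ω, |w ω| = w ω := fun ω => abs_of_nonneg (hw0 ω)
  have hset : {ω | ((y ω, α ω, w ω), fun i => d k j i ω) ∈ E} =
      {ω | ¬ ‖sassGrad l N₁ (fun i => d k j i ω) (y ω) (α ω) - ∇ (risk D l) (y ω)‖
      ≤ max εg (min τ (κ * α ω) * ‖sassGrad l N₁ (fun i => d k j i ω) (y ω) (α ω)‖)} := by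
    ext ω
    exact and_iff_right (hα0 ω)
  have key := setIntegral_le_of_indepFun (δ := δ) (w := fun p => |p.2.2|) hY' hξ'
    (hR.indepFun_of_disjoint hdisj hY hξ) hEm ?_ measurable_snd.snd.abs (fun _ => abs_nonneg _)
    (by simpa only [habs] using hint)
  · simp only [habs] at key
    rw [hset] at key
    exact ⟨hset ▸ (hY'.prodMk hξ') hEm, key⟩
  · rintro ⟨x, a, b⟩
    by_cases ha : 0 < a
    · have hgm : Measurable (fun S : Fin (N₁ a) → 𝒟 => batchGrad l S x) := by
        have hp : Measurable (fun S : Fin (N₁ a) → 𝒟 => (x, S)) := by fun_prop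
        have := (measurable_batchGrad hA.measurable_loss hA.differentiable_loss (N₁ a)).comp hp
        simpa only [Function.comp_def] using this
      have hBm : MeasurableSet {S : Fin (N₁ a) → 𝒟 | ‖batchGrad l S x - ∇ (risk D l) x‖
          ≤ max εg (min τ (κ * a) * ‖batchGrad l S x‖)} :=
        measurableSet_le (hgm.sub_const _).norm (measurable_const.max (hgm.norm.const_mul _))
      have h2 := hR.map_real_eq_pi k j (N₁ a) hBm.compl
      rw [probReal_compl_eq_one_sub hBm] at h2
      have h3 := h1 x a ha
      have h4 : {z : ℕ → 𝒟 | ((x, a, b), z) ∈ E} = {z | (fun i : Fin (N₁ a) => z i) ∈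
          {S : Fin (N₁ a) → 𝒟 | ‖batchGrad l S x - ∇ (risk D l) x‖
          ≤ max εg (min τ (κ * a) * ‖batchGrad l S x‖)}ᶜ} := by
        ext z
        exact and_iff_right ha
      rw [h4, h2]
      linarith
    · have h4 : {z : ℕ → 𝒟 | ((x, a, b), z) ∈ E} = ∅ :=
        Set.eq_empty_of_forall_notMem fun z hz => ha hz.1
      rw [h4, measureReal_empty]
      exact hδ

end SASSRandomness

/-! ### The stopping time and the expected penalty -/

theorem le_toNat_min_firstTime_iff (Q : ℕ → Prop) (n k : ℕ) :
    k ≤ (min (firstTime Q) n).toNat ↔ k ≤ n ∧ ∀ i < k, ¬ Q i := by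
  have hne : min (firstTime Q) (n : ℕ∞) ≠ ⊤ :=
    ne_top_of_le_ne_top (ENat.natCast_ne_top n) (min_le_right _ _)
  rw [← Nat.cast_le (α := ℕ∞), ENat.natCast_toNat hne, le_min_iff, firstTime, le_iInf₂_iff,
    Nat.cast_le, and_comm]
  refine and_congr_right fun _ => forall_congr' fun i => ?_
  rw [Nat.cast_le, ← not_lt]
  exact ⟨fun h h1 h2 => h h2 h1, fun h h1 h2 => h h2 h1⟩

/-- The event that none of the points `X 0, …, X (k - 1)` satisfies `Q`. -/
def activeSet {Ω E : Type*} (Q : E → Prop) (X : ℕ → Ω → E) (k : ℕ) : Set Ω :=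
  {ω | ∀ i < k, ¬ Q (X i ω)}

theorem measurableSet_activeSet {Ω E : Type*} {mΩ : MeasurableSpace Ω} [MeasurableSpace E]
    {Q : E → Prop} (hQ : MeasurableSet {x | Q x}) {X : ℕ → Ω → E} {k : ℕ}
    (hX : ∀ i < k, Measurable (X i)) : MeasurableSet (activeSet Q X k) := by
  have h : activeSet Q X k = ⋂ i, ⋂ (_ : i < k), (X i ⁻¹' {x | Q x})ᶜ := by
    ext ω
    simp [activeSet]
  rw [h]
  exact MeasurableSet.iInter fun i => MeasurableSet.iInter fun hi => (hX i hi hQ).compl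

/-- A sum of random length becomes a sum of fixed length over indicators, to which linearity of the
expectation applies. The index equal to the stopping time is still charged, so activity at `k`
concerns only the points before `k`. -/
theorem totalCost_toNat_min_firstTime {Ω E : Type*} (N₀ : ℕ) (N₁ : ℝ → ℕ) (Q : E → Prop)
    (X : ℕ → Ω → E) (A : ℕ → Ω → ℝ) (n : ℕ) (ω : Ω) :
    totalCost N₀ N₁ (fun k => A k ω) (min (firstTime fun k => Q (X k ω)) n).toNat
      = ∑ k ∈ Finset.Icc 1 n,
        (activeSet Q X k).indicator (fun ω => (N₀ : ℝ) + N₀ + N₁ (A k ω)) ω := by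
  classical
  have h : Finset.Icc 1 (min (firstTime fun k => Q (X k ω)) n).toNat
      = (Finset.Icc 1 n).filter fun k => ω ∈ activeSet Q X k := by
    ext k
    rw [Finset.mem_filter, Finset.mem_Icc, Finset.mem_Icc, le_toNat_min_firstTime_iff, and_assoc]
    rfl
  rw [totalCost, h, Finset.sum_filter]
  rfl

theorem measurable_stepPenalty (β : ℝ) : Measurable (stepPenalty β) :=
  ((measurable_const.div measurable_id).pow_const 2).max measurable_const

/-- The expected penalty of the step size parameters of SASS is bounded up to the stopping time. -/
theorem SASSRandomness.integral_stepPenalty_le {m : ℕ} {𝒟 Ω : Type*} [MeasurableSpace 𝒟]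
    [MeasurableSpace Ω] {D : Measure 𝒟} [IsProbabilityMeasure D] {P : Measure Ω}
    [IsProbabilityMeasure P] {h₁ h₂ : ℝ} {d : ℕ → Fin 3 → ℕ → Ω → 𝒟}
    {H : ℕ → Ω → Matrix (Fin m) (Fin m) ℝ} {l : EuclideanSpace ℝ (Fin m) → 𝒟 → ℝ} {L : ℝ≥0}
    {σf Mc Mv : ℝ} (hR : SASSRandomness D P h₁ h₂ d H) (hA : ERMAssumptions D l L σf Mc Mv)
    {N₀ : ℕ} {N₁ : ℝ → ℕ} (hN : Measurable N₁)
    {θ α₀ κ τ η δ₀ δ₁ p q β γ r ε εf : ℝ} {δfun : ℝ → ℝ} {αmax : ℝ≥0∞}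
    (hh₁ : 0 < h₁) (hh₂ : 0 < h₂) (hκ : 0 < κ) (hη : 0 < η) (hη' : η < 1)
    (hδ₀ : 0 < δ₀) (hδ₁ : 0 < δ₁) (hp : p = 1 - 2 * δ₀ - δ₁) (hp' : 1 / 2 < p) (hq : q = 1 - p)
    (hβ : 0 < β) (hβα : β ≤ α₀)
    (hβθ : max (η / (1 - η)) (κ * β) * √(h₂ / h₁) + L * β / (2 * h₁) ≤ 1 - θ)
    (hγ : 0 < γ) (hγ' : γ < 1) (hγq : 2 * q < γ ^ 2) (hmax : ENNReal.ofReal α₀ ≤ αmax)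
    (hr : 2 * εf < r) (h0 : SS0 D l N₀ εf δfun) (hδf : δfun (r / 2 - εf) ≤ δ₀)
    (h1 : SS1 D l N₁ (η * ε) τ κ δ₁) {Q : EuclideanSpace ℝ (Fin m) → Prop}
    (hQ : MeasurableSet {x | Q x}) (hQε : ∀ x, ¬ Q x → ε < ‖∇ (risk D l) x‖)
    {x₀ : EuclideanSpace ℝ (Fin m)} {X : ℕ → Ω → EuclideanSpace ℝ (Fin m)} {A : ℕ → Ω → ℝ}
    (hXA : ∀ k ω, (X k ω, A k ω) = sassPath l θ γ r αmax N₀ N₁ x₀ α₀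
      (fun i => H i ω) (fun i j t => d i j t ω) k) (k : ℕ) :
    MeasurableSet (activeSet Q X k) ∧ Measurable (A k) ∧ (∀ ω, 0 < A k ω) ∧
    Integrable ((activeSet Q X k).indicator fun ω => stepPenalty β (A k ω)) P ∧
    ∫ ω, (activeSet Q X k).indicator (fun ω => stepPenalty β (A k ω)) ω ∂P
      ≤ 2 / (q * (2 * p - 1)) := by
  have hq0 : 0 < q := by linarith
  have hm : ∀ k, Measurable[samplesIn d {a | a.1 < k}] fun ω => (X k ω, A k ω) := by
    intro k
    simp only [hXA]
    exact hR.measurable_sassPath hA hN θ γ r αmax N₀ x₀ α₀ k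
  have hmono : ∀ {i k : ℕ}, i ≤ k → samplesIn d {a | a.1 < i} ≤ samplesIn d {a | a.1 < k} :=
    fun h => samplesIn_mono d fun a (ha : a.1 < _) => ha.trans_le h
  have hX : ∀ k, Measurable[samplesIn d {a | a.1 < k}] (X k) := fun k => (hm k).fst
  have hAm : ∀ k, Measurable[samplesIn d {a | a.1 < k}] (A k) := fun k => (hm k).snd
  have hact : ∀ k, MeasurableSet[samplesIn d {a | a.1 < k}] (activeSet Q X k) := fun k =>
    measurableSet_activeSet (mΩ := samplesIn d {a | a.1 < k}) hQ
      fun i hi => (hX i).mono (hmono hi.le) le_rfl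
  set w : ℕ → Ω → ℝ := fun k => (activeSet Q X k).indicator fun ω => stepPenalty β (A k ω) with hw
  have hwm : ∀ k, Measurable[samplesIn d {a | a.1 < k}] (w k) := fun k =>
    Measurable.indicator (((measurable_stepPenalty β).comp (hAm k))) (hact k)
  have hpen0 : ∀ k ω, 0 ≤ stepPenalty β (A k ω) :=
    fun k ω => zero_le_one.trans (one_le_stepPenalty _ _)
  have hw0 : ∀ k ω, 0 ≤ w k ω := fun k => Set.indicator_nonneg fun ω _ => hpen0 k ω
  have hX0 : ∀ ω, A 0 ω = α₀ := fun ω => congrArg Prod.snd (hXA 0 ω)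
  have hstep : ∀ k ω, A (k + 1) ω = (sassStep l θ γ r αmax N₀ N₁ (H k ω) (fun j t => d k j t ω)
      (X k ω, A k ω)).2 := by
    intro k ω
    rw [hXA k ω]
    exact congrArg Prod.snd (hXA (k + 1) ω)
  have hone := fun k ω (hα : 0 < A k ω) => stepPenalty_sassStep_le hA.differentiable_risk
    hA.lipschitz_gradient hh₁ hh₂ hκ hη hη' hβ hβα hβθ hγ hγ' hmax (hR.posDef k ω)
    (hR.lower k ω) (hR.upper k ω) N₀ N₁ (fun j t => d k j t ω) (X k ω) hα (hstep k ω)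
  have hpos : ∀ k ω, 0 < A k ω := by
    intro k ω
    induction k with
    | zero => rw [hX0]; linarith
    | succ k ih => exact (hone k ω ih).1
  have hγ2 : 0 < γ ^ 2 := by positivity
  have hγ1 : γ ^ 2 < 1 := pow_lt_one₀ hγ.le hγ' two_ne_zero
  have hinv : 1 < 1 / γ ^ 2 := (one_lt_div hγ2).2 hγ1
  -- This crude exponential bound serves only for integrability.
  have hpen_le : ∀ k ω, stepPenalty β (A k ω) ≤ (1 / γ ^ 2) ^ k := by
    intro k ω
    induction k with
    | zero => rw [hX0, stepPenalty_eq_one hβ hβα, pow_zero]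
    | succ k ih =>
      refine (hone k ω (hpos k ω)).2.1.trans ?_
      rw [pow_succ, div_eq_mul_one_div (stepPenalty β (A k ω))]
      exact mul_le_mul_of_nonneg_right ih (by positivity)
  have hwint : ∀ k, Integrable (w k) P := fun k =>
    Integrable.of_bound ((hwm k).mono (hR.samplesIn_le _) le_rfl).aestronglyMeasurable
      ((1 / γ ^ 2) ^ k) (Filter.Eventually.of_forall fun ω => by
        rw [Real.norm_of_nonneg (hw0 k ω)]
        exact Set.indicator_apply_le' (fun _ => hpen_le k ω) fun _ => by positivity)
  refine ⟨hR.samplesIn_le _ _ (hact k), (hAm k).mono (hR.samplesIn_le _) le_rfl, hpos k,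
    hwint k, ?_⟩
  -- the three events on which the estimates of iteration `k` are inaccurate
  set t : ℕ → Ω → EuclideanSpace ℝ (Fin m) := fun k ω =>
    sassTrial l N₁ (H k ω) (fun i => d k 2 i ω) (X k ω) (A k ω) with ht
  -- The trial point depends on the gradient samples of iteration `k` as well as on the past. Stream
  -- `1` of that iteration lies outside `J k`, so it is still fresh for the estimate at the trial
  -- point.
  set J : ℕ → Set (ℕ × Fin 3 × ℕ) := fun k => {a | a.1 < k ∨ a.1 = k ∧ a.2.1 = 2} with hJ
  have hJle : ∀ k, samplesIn d {a | a.1 < k} ≤ samplesIn d (J k) :=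
    fun k => samplesIn_mono d fun a ha => Or.inl ha
  have htm : ∀ k, Measurable[samplesIn d (J k)] fun ω => X k ω + t k ω := fun k =>
    ((hX k).mono (hJle k) le_rfl).add (measurable_sassTrial (mΩ := samplesIn d (J k))
      hA.measurable_loss hA.differentiable_loss hN
      (fun a b => (hR.adapted k a b).mono ((pastSamples_le_samplesIn d k).trans (hJle k)) le_rfl)
      ((hX k).mono (hJle k) le_rfl) ((hAm k).mono (hJle k) le_rfl)
      (measurable_samplesIn d fun i => Or.inr ⟨rfl, rfl⟩))
  have hpastI : ∀ (k : ℕ) (j : Fin 3) (i : ℕ), (k, j, i) ∉ {a : ℕ × Fin 3 × ℕ | a.1 < k} :=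
    fun k j i h => lt_irrefl k h
  -- The oracle is used with `t = r / 2 - εf`, so that its tolerance is `r / 2`.
  have hB0 := fun k => hR.setIntegral_value_le hA h0 (sub_pos.2 (by linarith : εf < r / 2))
    (hpastI k 0) (hX k) (hwm k) (hw0 k) (hwint k)
  have hB1 := fun k => hR.setIntegral_value_le hA h0 (sub_pos.2 (by linarith : εf < r / 2))
    (I := J k) (k := k) (j := 1) (fun i h => by
      rcases h with h | h
      · exact lt_irrefl k h
      · exact absurd (show (1 : Fin 3) = 2 from h.2) (by decide))
    (htm k) ((hwm k).mono (hJle k) le_rfl) (hw0 k) (hwint k)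
  have hB2 := fun k => hR.setIntegral_grad_le hA hN h1 hδ₁.le
    (hpastI k 2) (hX k) (hAm k) (hpos k) (hwm k) (hw0 k) (hwint k)
  rw [add_sub_cancel] at hB0 hB1
  set B : ℕ → Fin 3 → Set Ω := fun k =>
    ![{ω | ¬ |risk D l (X k ω) - batchValue l (fun i : Fin N₀ => d k 0 i ω) (X k ω)| < r / 2},
      {ω | ¬ |risk D l (X k ω + t k ω)
        - batchValue l (fun i : Fin N₀ => d k 1 i ω) (X k ω + t k ω)| < r / 2},
      {ω | ¬ ‖sassGrad l N₁ (fun i => d k 2 i ω) (X k ω) (A k ω) - ∇ (risk D l) (X k ω)‖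
        ≤ max (η * ε) (min τ (κ * A k ω)
          * ‖sassGrad l N₁ (fun i => d k 2 i ω) (X k ω) (A k ω)‖)}] with hB
  have hsum : ∑ j, (![δ₀, δ₀, δ₁] : Fin 3 → ℝ) j = q := by
    rw [Fin.sum_univ_three]
    simp only [Matrix.cons_val]
    linarith
  have hwI : ∀ k, 0 ≤ ∫ ω, w k ω ∂P := fun k => integral_nonneg (hw0 k)
  -- On a bad event `s w + b w = w / γ²` is the worst-case growth, so one inequality covers good and
  -- bad iterations.
  refine integral_le_of_drift (w := w) (B := B) (δ := ![δ₀, δ₀, δ₁]) (s := γ ^ 2)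
    (b := 1 / γ ^ 2 - γ ^ 2) hγ2.le (by linarith) hwint ?_ ?_ ?_ ?_ ?_ ?_ k
  · intro k j
    fin_cases j
    exacts [(hB0 k).1, (hB1 k).1, (hB2 k).1]
  · have h2 : ∀ ω, w 0 ω ≤ 1 := fun ω => Set.indicator_apply_le'
      (fun _ => by rw [hX0, stepPenalty_eq_one hβ hβα]) fun _ => zero_le_one
    calc ∫ ω, w 0 ω ∂P ≤ ∫ _, (1 : ℝ) ∂P := integral_mono (hwint 0) (integrable_const 1) h2
      _ = 1 := by simp
      _ ≤ 2 / (q * (2 * p - 1)) := by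
        rw [le_div_iff₀ (mul_pos hq0 (by linarith))]
        nlinarith
  · intro k ω
    have hind : ∀ j, 0 ≤ (B k j).indicator (w k) ω :=
      fun j => Set.indicator_nonneg (fun ω _ => hw0 k ω) ω
    have hb : 0 ≤ 1 / γ ^ 2 - γ ^ 2 := by linarith
    have hrhs : 0 ≤ γ ^ 2 * w k ω + (1 / γ ^ 2 - γ ^ 2)
        + (1 / γ ^ 2 - γ ^ 2) * ∑ j, (B k j).indicator (w k) ω :=
      add_nonneg (add_nonneg (mul_nonneg hγ2.le (hw0 k ω)) hb)
        (mul_nonneg hb (Finset.sum_nonneg fun j _ => hind j))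
    -- Activity at `k + 1` says that `X k` does not satisfy `Q`, which provides the large gradient
    -- needed for contraction; otherwise the new weight is `0`.
    by_cases hact' : ω ∈ activeSet Q X (k + 1)
    swap
    · have : w (k + 1) ω = 0 := Set.indicator_of_notMem hact' _
      rw [this]
      exact hrhs
    have hactk : ω ∈ activeSet Q X k := fun i hi => hact' i (Nat.lt_succ_of_lt hi)
    have hw1 : w (k + 1) ω = stepPenalty β (A (k + 1) ω) := Set.indicator_of_mem hact' _
    have hwk : w k ω = stepPenalty β (A k ω) := Set.indicator_of_mem hactk _
    obtain ⟨-, hgrow, hgood⟩ := hone k ω (hpos k ω)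
    by_cases hbad : ∃ j, ω ∈ B k j
    · obtain ⟨j, hj⟩ := hbad
      have h3 : w k ω ≤ ∑ j, (B k j).indicator (w k) ω := by
        calc w k ω = (B k j).indicator (w k) ω := (Set.indicator_of_mem hj _).symm
          _ ≤ _ := Finset.single_le_sum (fun j _ => hind j) (Finset.mem_univ j)
      have h4 := mul_le_mul_of_nonneg_left h3 hb
      have h5 : stepPenalty β (A k ω) / γ ^ 2 = 1 / γ ^ 2 * w k ω := by rw [hwk]; ring
      rw [hw1]
      linarith
    · push Not at hbad
      have h3 := hgood ε τ (hQε _ (hact' k (Nat.lt_succ_self k)))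
        (not_not.1 (hbad 0)) (not_not.1 (hbad 1)) (not_not.1 (hbad 2))
      have h4 : 0 ≤ (1 / γ ^ 2 - γ ^ 2) * ∑ j, (B k j).indicator (w k) ω :=
        mul_nonneg hb (Finset.sum_nonneg fun j _ => hind j)
      rw [hw1]
      rw [← hwk] at h3
      linarith
  · intro k j
    fin_cases j
    · exact (hB0 k).2.trans (mul_le_mul_of_nonneg_right hδf (hwI k))
    · exact (hB1 k).2.trans (mul_le_mul_of_nonneg_right hδf (hwI k))
    · exact (hB2 k).2
  · rw [hsum]
    exact hq0.le
  · rw [hsum]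
    exact drift_bound hq0 hp' hq hγq hγ1

/-! ### From the penalty to the expected cost -/

/-- The reciprocal square of a minimum is at most the sum of the two reciprocal squares, and `1 / (κ
α)² = (β / α)² / (κ β)²`. Thus the gradient sample size is bounded by an affine function of the
penalty. -/
theorem div_min_sq_le {τ κ α β e : ℝ} (hτ : 0 < τ) (hκ : 0 < κ) (hα : 0 < α) (hβ : 0 < β)
    (he : 0 ≤ e) : e / min τ (κ * α) ^ 2 ≤ e * (1 / τ ^ 2 + stepPenalty β α / (κ * β) ^ 2) := by
  rw [div_eq_mul_one_div]
  refine mul_le_mul_of_nonneg_left ?_ he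
  have h1 : 0 ≤ stepPenalty β α / (κ * β) ^ 2 :=
    div_nonneg (zero_le_one.trans (one_le_stepPenalty _ _)) (sq_nonneg _)
  have h2 : 0 ≤ 1 / τ ^ 2 := by positivity
  rcases min_choice τ (κ * α) with h | h <;> rw [h]
  · linarith
  · have h3 : 1 / (κ * α) ^ 2 = (β / α) ^ 2 / (κ * β) ^ 2 := by field_simp
    have h4 : (β / α) ^ 2 / (κ * β) ^ 2 ≤ stepPenalty β α / (κ * β) ^ 2 := by
      gcongr
      exact le_max_left _ _
    linarith

/-- The expected cost up to a stopping time is controlled by the expected step size penalties. -/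
theorem integral_totalCost_le {Ω E : Type*} [MeasurableSpace Ω] {P : Measure Ω}
    [IsProbabilityMeasure P] {N₀ : ℕ} {N₁ : ℝ → ℕ} (hN : Measurable N₁) {Q : E → Prop}
    {X : ℕ → Ω → E} {A : ℕ → Ω → ℝ} {τ κ β c e M : ℝ} (hτ : 0 < τ) (hκ : 0 < κ) (hβ : 0 < β)
    (hc : 0 ≤ c) (he : 0 ≤ e)
    (hsize : ∀ α > 0, (N₁ α : ℝ) ≤ c + e / min τ (κ * α) ^ 2)
    (h : ∀ k, MeasurableSet (activeSet Q X k) ∧ Measurable (A k) ∧ (∀ ω, 0 < A k ω) ∧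
      Integrable ((activeSet Q X k).indicator fun ω => stepPenalty β (A k ω)) P ∧
      ∫ ω, (activeSet Q X k).indicator (fun ω => stepPenalty β (A k ω)) ω ∂P ≤ M) (n : ℕ) :
    Integrable (fun ω => totalCost N₀ N₁ (fun k => A k ω)
      (min (firstTime fun k => Q (X k ω)) n).toNat) P ∧
    ∫ ω, totalCost N₀ N₁ (fun k => A k ω) (min (firstTime fun k => Q (X k ω)) n).toNat ∂P
      ≤ n * (2 * N₀ + c + e * (1 / τ ^ 2 + M / (κ * β) ^ 2)) := by
  set f : ℕ → Ω → ℝ := fun k =>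
    (activeSet Q X k).indicator fun ω => (N₀ : ℝ) + N₀ + N₁ (A k ω) with hf
  set g : ℕ → Ω → ℝ := fun k ω => (2 * N₀ + c + e / τ ^ 2) + e / (κ * β) ^ 2 *
    (activeSet Q X k).indicator (fun ω => stepPenalty β (A k ω)) ω with hg
  have hgint : ∀ k, Integrable (g k) P := fun k =>
    (integrable_const _).add ((h k).2.2.2.1.const_mul _)
  have hf0 : ∀ k ω, 0 ≤ f k ω := fun k => Set.indicator_nonneg fun ω _ => by positivity
  have hfg : ∀ k ω, f k ω ≤ g k ω := by
    intro k ω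
    by_cases hω : ω ∈ activeSet Q X k
    · simp only [hf, hg, Set.indicator_of_mem hω]
      have h1 := hsize _ ((h k).2.2.1 ω)
      have h2 := div_min_sq_le hτ hκ ((h k).2.2.1 ω) hβ he
      have h3 : e * (1 / τ ^ 2 + stepPenalty β (A k ω) / (κ * β) ^ 2)
        = e / τ ^ 2 + e / (κ * β) ^ 2 * stepPenalty β (A k ω) := by ring
      linarith
    · simp only [hf, hg, Set.indicator_of_notMem hω]
      positivity
  have hfint : ∀ k, Integrable (f k) P := fun k => by
    have hN' : Measurable fun ω => (N₁ (A k ω) : ℝ) :=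
      measurable_from_nat.comp (hN.comp (h k).2.1)
    refine (hgint k).mono' ((hN'.const_add _).indicator (h k).1).aestronglyMeasurable
      (Filter.Eventually.of_forall fun ω => ?_)
    rw [Real.norm_of_nonneg (hf0 k ω)]
    exact hfg k ω
  have hfle : ∀ k, ∫ ω, f k ω ∂P ≤ 2 * N₀ + c + e * (1 / τ ^ 2 + M / (κ * β) ^ 2) := by
    intro k
    refine (integral_mono (hfint k) (hgint k) (hfg k)).trans ?_
    rw [integral_add (integrable_const _) ((h k).2.2.2.1.const_mul _), integral_const_mul]
    simp only [integral_const, probReal_univ, one_smul]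
    have h1 := mul_le_mul_of_nonneg_left (h k).2.2.2.2
      (div_nonneg he (sq_nonneg (κ * β)))
    have h2 : e * (1 / τ ^ 2 + M / (κ * β) ^ 2) = e / τ ^ 2 + e / (κ * β) ^ 2 * M := by ring
    linarith
  simp only [totalCost_toNat_min_firstTime]
  refine ⟨integrable_finsetSum _ fun k _ => hfint k, ?_⟩
  rw [integral_finsetSum _ fun k _ => hfint k]
  refine (Finset.sum_le_card_nsmul _ _ _ fun k _ => hfle k).trans (le_of_eq ?_)
  rw [Nat.card_Icc, Nat.add_sub_cancel, nsmul_eq_mul]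

/-- Comparison of the raw cost bound with the two forms of the complexity bound. -/
theorem cost_bound_le {K S M V b u u₀ : ℝ} {n : ℕ} (hK : 0 < K) (hS : 0 ≤ S) (hM : 0 ≤ M)
    (hV : 0 ≤ V) (hb : 0 ≤ b) (hu₀ : 0 < u₀) (hu : u₀ ≤ u) :
    n * (2 * (K * S) + K * M + K * V * b) ≤ K * (2 + b / u₀) * (n * (S + M + V * u)) := by
  have h1 : b ≤ b / u₀ * u := by
    calc b = b / u₀ * u₀ := by field_simp
      _ ≤ b / u₀ * u := by gcongr
  have hu0 : 0 ≤ u := hu₀.le.trans hu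
  have hn : (0 : ℝ) ≤ n := n.cast_nonneg
  have hr : 0 ≤ b / u₀ := by positivity
  have h2 : K * V * b ≤ K * V * (b / u₀ * u) := by gcongr
  have h3 : 0 ≤ K * (M + 2 * (V * u) + b / u₀ * (S + M)) := by positivity
  calc n * (2 * (K * S) + K * M + K * V * b)
      ≤ n * (2 * (K * S) + K * M + K * V * (b / u₀ * u)
        + K * (M + 2 * (V * u) + b / u₀ * (S + M))) := by
        refine mul_le_mul_of_nonneg_left ?_ hn
        linarith
    _ = _ := by ring

/-- The gradient is large as long as the optimality gap of a strongly convex function is. -/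
theorem StrongConvexOn.sqrt_lt_norm_gradient {E : Type*} [NormedAddCommGroup E]
    [InnerProductSpace ℝ E] [CompleteSpace E] {f : E → ℝ} {μ ε : ℝ} (hμ : 0 < μ) (hε : 0 < ε)
    (hf : Differentiable ℝ f) (hc : StrongConvexOn Set.univ μ f) {x : E}
    (hx : ¬ f x - (⨅ y, f y) ≤ ε) : √(2 * μ * ε) < ‖∇ f x‖ := by
  -- The Polyak-Łojasiewicz inequality against every `y` passes to the infimum, so no minimizer is
  -- needed.
  have h1 : f x - ‖∇ f x‖ ^ 2 / (2 * μ) ≤ ⨅ y, f y := by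
    refine le_ciInf fun y => ?_
    have h2 : f x - f y ≤ ‖∇ f x‖ ^ 2 / (2 * μ) := by
      rw [le_div_iff₀ (by positivity)]
      linarith [hc.sub_le_norm_gradient_sq hμ hf x y]
    linarith
  have h3 : ε < ‖∇ f x‖ ^ 2 / (2 * μ) := by linarith
  rw [lt_div_iff₀ (by positivity)] at h3
  have h4 : 0 < ‖∇ f x‖ := by
    refine norm_pos_iff.2 fun h => ?_
    rw [h, norm_zero] at h3
    have : 0 < ε * (2 * μ) := by positivity
    linarith
  rw [Real.sqrt_lt' h4]
  linarith

/-! ### Choice of the constants and conclusion -/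

theorem mainTheorem8
    -- constants of the problem class, of the algorithm and of the oracles
    (L : ℝ≥0) (μ θ α₀ h₁ h₂ κ τ η ρ δ₀ δ₁ p q : ℝ)
    (hμ : 0 < μ) (hθ : 0 < θ) (hθ' : θ < 1) (hα₀ : 0 < α₀) (hh₁ : 0 < h₁) (hh₂ : h₁ ≤ h₂)
    (hκ : 0 < κ) (hτ : 0 < τ) (hρ : 0 < ρ)
    (hη : 0 < η) (hη' : η < 1) (hηθ : η / (1 - η) * √(h₂ / h₁) < 1 - θ)
    (hδ₀ : 0 < δ₀) (hδ₁ : 0 < δ₁)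
    (hp : p = 1 - 2 * δ₀ - δ₁) (hp' : 1 / 2 < p) (hq : q = 1 - p) :
    ∃ a > 0, ∀ K > 0, ∃ C : ℝ,
      ∀ (m : ℕ) (𝒟 : Type u) [MeasurableSpace 𝒟] (D : Measure 𝒟) [IsProbabilityMeasure D]
        (l : EuclideanSpace ℝ (Fin m) → 𝒟 → ℝ) (σf Mc Mv ε : ℝ) (N₀ : ℕ) (N₁ : ℝ → ℕ),
        0 ≤ σf → 0 ≤ Mc → 0 ≤ Mv → 0 < ε → Measurable N₁ →
        ERMAssumptions D l L σf Mc Mv →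
        -- minibatches of the stated order of magnitude yield the oracles, non-convex case
        (1 ≤ N₀ → a * (σf ^ 2 / ε ^ 4) ≤ N₀ → SS0 D l N₀ (ρ * ε ^ 2) (fun _ => δ₀)) ∧
        ((∀ α > 0, 1 ≤ N₁ α ∧ a * (Mc / ε ^ 2 + Mv / min τ (κ * α) ^ 2) ≤ N₁ α) →
          SS1 D l N₁ (η * ε) τ κ δ₁) ∧
        -- the same in the strongly convex case
        (1 ≤ N₀ → a * (σf ^ 2 / ε ^ 2) ≤ N₀ → SS0 D l N₀ (ρ * ε) (fun _ => δ₀)) ∧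
        ((∀ α > 0, 1 ≤ N₁ α ∧ a * (Mc / ε + Mv / min τ (κ * α) ^ 2) ≤ N₁ α) →
          SS1 D l N₁ (η * √(2 * μ * ε)) τ κ δ₁) ∧
        -- expected total sample complexity of SASS
        ∀ (Ω : Type v) [MeasurableSpace Ω] (P : Measure Ω) [IsProbabilityMeasure P]
          (d : ℕ → Fin 3 → ℕ → Ω → 𝒟) (H : ℕ → Ω → Matrix (Fin m) (Fin m) ℝ)
          (γ r εf : ℝ) (δfun : ℝ → ℝ) (αmax : ℝ≥0∞) (x₀ : EuclideanSpace ℝ (Fin m))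
          (X : ℕ → Ω → EuclideanSpace ℝ (Fin m)) (A : ℕ → Ω → ℝ) (n : ℕ),
          SASSRandomness D P h₁ h₂ d H →
          (∀ k ω, (X k ω, A k ω) = sassPath l θ γ r αmax N₀ N₁ x₀ α₀
            (fun i => H i ω) (fun i j t => d i j t ω) k) →
          ENNReal.ofReal α₀ ≤ αmax →
          √(2 * q) < γ → γ < 1 → 2 ≤ n →
          0 ≤ εf → 2 * εf < r → SS0 D l N₀ εf δfun → δfun (r / 2 - εf) ≤ δ₀ →
          -- non-convex case
          (SS1 D l N₁ (η * ε) τ κ δ₁ →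
            (N₀ : ℝ) ≤ K * (σf ^ 2 / ε ^ 4) →
            (∀ α > 0, (N₁ α : ℝ) ≤ K * (Mc / ε ^ 2 + Mv / min τ (κ * α) ^ 2)) →
            Integrable (fun ω => tocNonconvex (risk D l) ε N₀ N₁
              (fun k => X k ω) (fun k => A k ω) n) P ∧
            ∫ ω, tocNonconvex (risk D l) ε N₀ N₁ (fun k => X k ω) (fun k => A k ω) n ∂P
              ≤ C * (σf ^ 2 / ε ^ 4 * n + Mc / ε ^ 2 * n
                + Mv * n * ((n : ℝ) ^ Real.logb (p / q) (1 / γ ^ 2) * Real.logb (p / q) n)) ∧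
            ∀ c > 1, (q / p) ^ (Real.log c / (2 * Real.log n)) ≤ γ →
              ∫ ω, tocNonconvex (risk D l) ε N₀ N₁ (fun k => X k ω) (fun k => A k ω) n ∂P
                ≤ C * (n * (σf ^ 2 / ε ^ 4 + Mc / ε ^ 2 + Mv * Real.log n))) ∧
          -- strongly convex case
          (StrongConvexOn Set.univ μ (risk D l) →
            SS1 D l N₁ (η * √(2 * μ * ε)) τ κ δ₁ →
            (N₀ : ℝ) ≤ K * (σf ^ 2 / ε ^ 2) →
            (∀ α > 0, (N₁ α : ℝ) ≤ K * (Mc / ε + Mv / min τ (κ * α) ^ 2)) →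
            Integrable (fun ω => tocStronglyConvex (risk D l) ε N₀ N₁
              (fun k => X k ω) (fun k => A k ω) n) P ∧
            ∫ ω, tocStronglyConvex (risk D l) ε N₀ N₁ (fun k => X k ω) (fun k => A k ω) n ∂P
              ≤ C * (σf ^ 2 / ε ^ 2 * n + Mc / ε * n
                + Mv * n * ((n : ℝ) ^ Real.logb (p / q) (1 / γ ^ 2) * Real.logb (p / q) n)) ∧
            ∀ c > 1, (q / p) ^ (Real.log c / (2 * Real.log n)) ≤ γ →
              ∫ ω, tocStronglyConvex (risk D l) ε N₀ N₁ (fun k => X k ω) (fun k => A k ω) n ∂P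
                ≤ C * (n * (σf ^ 2 / ε ^ 2 + Mc / ε + Mv * Real.log n))) := by
  have hh₂' : 0 < h₂ := hh₁.trans_le hh₂
  have hq0 : 0 < q := by linarith
  have hpq : 1 < p / q := (one_lt_div hq0).2 (by linarith)
  obtain ⟨β, hβ, hβα, hβθ⟩ :=
    exists_step_threshold (κ := κ) (L := L) hα₀ hη hη' hηθ
  -- The four summands serve, in order, the function values, the `Mc` term in the non-convex case,
  -- the `Mv` term, and the `Mc` term in the strongly convex case, where `εg² = 2 η² μ ε`.
  set a : ℝ := 1 / (ρ ^ 2 * δ₀) + 2 / (η ^ 2 * δ₁) + 2 * (1 + τ) ^ 2 / δ₁ + 1 / (η ^ 2 * μ * δ₁)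
    with ha
  have ha1 : 1 / (ρ ^ 2 * δ₀) ≤ a := by
    rw [ha]; have : 0 < 2 / (η ^ 2 * δ₁) + 2 * (1 + τ) ^ 2 / δ₁ + 1 / (η ^ 2 * μ * δ₁) := by
      positivity
    linarith
  have ha2 : 2 / (η ^ 2 * δ₁) ≤ a := by
    rw [ha]; have : 0 < 1 / (ρ ^ 2 * δ₀) + 2 * (1 + τ) ^ 2 / δ₁ + 1 / (η ^ 2 * μ * δ₁) := by
      positivity
    linarith
  have ha3 : 2 * (1 + τ) ^ 2 / δ₁ ≤ a := by
    rw [ha]; have : 0 < 1 / (ρ ^ 2 * δ₀) + 2 / (η ^ 2 * δ₁) + 1 / (η ^ 2 * μ * δ₁) := by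
      positivity
    linarith
  have ha4 : 1 / (η ^ 2 * μ * δ₁) ≤ a := by
    rw [ha]; have : 0 < 1 / (ρ ^ 2 * δ₀) + 2 / (η ^ 2 * δ₁) + 2 * (1 + τ) ^ 2 / δ₁ := by
      positivity
    linarith
  have ha0 : 0 < a := by positivity
  have hvalue : ∀ {v w N : ℝ}, 0 ≤ v → 0 < w → a * (v / w ^ 2) ≤ N →
      v / (ρ * w) ^ 2 ≤ δ₀ * N := by
    intro v w N hv hw h
    calc v / (ρ * w) ^ 2 = δ₀ * (1 / (ρ ^ 2 * δ₀) * (v / w ^ 2)) := by field_simp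
      _ ≤ δ₀ * (a * (v / w ^ 2)) := by gcongr
      _ ≤ δ₀ * N := by gcongr
  have hgrad : ∀ {v v' w w' N b : ℝ}, 0 ≤ v → 0 ≤ v' → 2 * (w / w') ≤ a * v * δ₁ →
      a * (v + v' / b ^ 2) ≤ N → 2 * (w / w' + (1 + τ) ^ 2 * (v' / b ^ 2)) ≤ δ₁ * N := by
    intro v v' w w' N b hv hv' h1 h2
    have h3 : 2 * (1 + τ) ^ 2 * (v' / b ^ 2) ≤ a * δ₁ * (v' / b ^ 2) :=
      mul_le_mul_of_nonneg_right ((div_le_iff₀ hδ₁).1 ha3) (by positivity)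
    have h4 := mul_le_mul_of_nonneg_left h2 hδ₁.le
    linarith
  -- This bounds the expected value of `1 / min τ (κ α)²` over active runs.
  set b : ℝ := 1 / τ ^ 2 + 2 / (q * (2 * p - 1)) / (κ * β) ^ 2 with hb
  have h2p : 0 < 2 * p - 1 := by linarith
  have hb0 : 0 < b := by positivity
  have hlb : 0 < Real.logb (p / q) 2 := Real.logb_pos hpq one_lt_two
  have hl2 : 0 < Real.log 2 := Real.log_pos one_lt_two
  -- For `n ≥ 2` both logarithms of `n` are at least `u₀`, and the power of `n` is at least `1`
  -- because `1 / γ² ≥ 1`.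
  set u₀ : ℝ := min (Real.logb (p / q) 2) (Real.log 2) with hu₀
  have hu₀0 : 0 < u₀ := lt_min hlb hl2
  refine ⟨a, ha0, fun K hK => ⟨K * (2 + b / u₀), ?_⟩⟩
  intro m 𝒟 _ D _ l σf Mc Mv ε N₀ N₁ hσf hMc hMv hε hN hA
  have hsc : √(2 * μ * ε) ^ 2 = 2 * μ * ε := Real.sq_sqrt (by positivity)
  have hsc0 : 0 < √(2 * μ * ε) := Real.sqrt_pos.2 (by positivity)
  refine ⟨?_, ?_, ?_, ?_, ?_⟩
  · intro hN0 h
    refine SS0.of_le_size hA hN0 (by positivity) (hvalue (sq_nonneg _) (by positivity) ?_)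
    rwa [← pow_mul]
  · intro h
    refine SS1.of_le_size hA hMc hMv (by positivity) hτ hκ (fun α hα => (h α hα).1)
      fun α hα => hgrad (by positivity) hMv ?_ (h α hα).2
    calc 2 * (Mc / (η * ε) ^ 2) = 2 / (η ^ 2 * δ₁) * (Mc / ε ^ 2) * δ₁ := by field_simp
      _ ≤ _ := by gcongr
  · intro hN0 h
    exact SS0.of_le_size hA hN0 (by positivity) (hvalue (sq_nonneg _) hε h)
  · intro h
    refine SS1.of_le_size hA hMc hMv (by positivity) hτ hκ (fun α hα => (h α hα).1)
      fun α hα => hgrad (by positivity) hMv ?_ (h α hα).2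
    rw [mul_pow, hsc]
    calc 2 * (Mc / (η ^ 2 * (2 * μ * ε))) = 1 / (η ^ 2 * μ * δ₁) * (Mc / ε) * δ₁ := by field_simp
      _ ≤ _ := by gcongr
  intro Ω _ P _ d H γ r εf δfun αmax x₀ X A n hR hXA hmax hγq hγ' hn hεf hr h0 hδf
  have hγ : 0 < γ := (Real.sqrt_nonneg _).trans_lt hγq
  have hγq' : 2 * q < γ ^ 2 := by
    have := (Real.sqrt_lt' hγ).1 hγq
    exact this
  have hn1 : (1 : ℝ) ≤ n := by exact_mod_cast one_le_two.trans hn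
  have hn2 : (2 : ℝ) ≤ n := by exact_mod_cast hn
  have hlogn : u₀ ≤ Real.log n :=
    (min_le_right _ _).trans (Real.log_le_log two_pos hn2)
  have hpow : u₀ ≤ (n : ℝ) ^ Real.logb (p / q) (1 / γ ^ 2) * Real.logb (p / q) n := by
    have h1 : Real.logb (p / q) 2 ≤ Real.logb (p / q) n :=
      Real.logb_le_logb_of_le hpq two_pos hn2
    have h2 : 0 ≤ Real.logb (p / q) (1 / γ ^ 2) :=
      Real.logb_nonneg hpq ((one_le_div (by positivity)).2 (pow_le_one₀ hγ.le hγ'.le))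
    exact (min_le_left _ _).trans (h1.trans
      (le_mul_of_one_le_left (hlb.le.trans h1) (Real.one_le_rpow hn1 h2)))
  -- the common bound for a stopping rule before which the gradient is larger than `ε'`
  have main : ∀ (ε' S M : ℝ) (Q : EuclideanSpace ℝ (Fin m) → Prop), 0 ≤ S → 0 ≤ M →
      MeasurableSet {x | Q x} → (∀ x, ¬ Q x → ε' < ‖∇ (risk D l) x‖) →
      SS1 D l N₁ (η * ε') τ κ δ₁ → (N₀ : ℝ) ≤ K * S →
      (∀ α > 0, (N₁ α : ℝ) ≤ K * (M + Mv / min τ (κ * α) ^ 2)) →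
      Integrable (fun ω => totalCost N₀ N₁ (fun k => A k ω)
        (min (firstTime fun k => Q (X k ω)) n).toNat) P ∧
      ∀ u, u₀ ≤ u → ∫ ω, totalCost N₀ N₁ (fun k => A k ω)
        (min (firstTime fun k => Q (X k ω)) n).toNat ∂P
        ≤ K * (2 + b / u₀) * (n * (S + M + Mv * u)) := by
    intro ε' S M Q hS hM hQ hQε h1 hN0 hN1
    obtain ⟨hi, hle⟩ := integral_totalCost_le (Q := Q) (X := X) (A := A) (c := K * M)
      (e := K * Mv) hN hτ hκ hβ (by positivity) (by positivity)
      (fun α hα => (hN1 α hα).trans (le_of_eq (by ring)))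
      (fun k => hR.integral_stepPenalty_le hA hN hh₁ hh₂' hκ hη hη' hδ₀ hδ₁ hp hp' hq hβ hβα
        hβθ hγ hγ' hγq' hmax hr h0 hδf h1 hQ hQε hXA k) n
    refine ⟨hi, fun u hu => hle.trans (le_trans ?_
      (cost_bound_le hK hS hM hMv hb0.le hu₀0 hu))⟩
    gcongr
  have hG : Continuous (∇ (risk D l)) := hA.lipschitz_gradient.continuous
  have hφ : Continuous (risk D l) := hA.differentiable_risk.continuous
  constructor
  · intro h1 hN0 hN1
    obtain ⟨hi, hle⟩ := main ε (σf ^ 2 / ε ^ 4) (Mc / ε ^ 2) (fun x => ‖∇ (risk D l) x‖ ≤ ε)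
      (by positivity) (by positivity) (measurableSet_le hG.norm.measurable measurable_const)
      (fun x hx => not_le.1 hx) h1 hN0 hN1
    exact ⟨hi, (hle _ hpow).trans (le_of_eq (by ring)), fun c _ _ => hle _ hlogn⟩
  · intro hsconv h1 hN0 hN1
    obtain ⟨hi, hle⟩ := main √(2 * μ * ε) (σf ^ 2 / ε ^ 2) (Mc / ε)
      (fun x => risk D l x - (⨅ y, risk D l y) ≤ ε)
      (by positivity) (by positivity)
      (measurableSet_le (hφ.measurable.sub_const _) measurable_const)
      (fun x hx => hsconv.sqrt_lt_norm_gradient hμ hε hA.differentiable_risk hx) h1 hN0 hN1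
    exact ⟨hi, (hle _ hpow).trans (le_of_eq (by ring)), fun c _ _ => hle _ hlogn⟩
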